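/- Let $n\ge 3$ and $1\le m\le n-2$ be integers. A collector draws with replacement from $n$ distinct coupons; the draws are independent and each is uniformly distributed on the $n$ coupons. Let $W_{n,m}$ be the number of draws needed to have, for the first time, $n-m$ distinct coupons, and let $$\mu_n=\mathbb E\,W_{n,m}=n\sum_{k=m+1}^{n}\frac1k,\qquad \sigma_n^2=\operatorname{Var}W_{n,m}=n\sum_{k=m+1}^{n}\frac{n-k}{k^2},\qquad \sigma_n=\sqrt{\sigma_n^2}.$$ With $F_{n,m}(x)=\mathbb P\big((W_{n,m}-\mu_n)/\sigma_n\le x\big)$ and $\Phi(x)=\frac1{\sqrt{2\pi}}\int_{-\infty}^x e^{-s^2/2}\,ds$ we have $$\sup_{x\in\mathbb R}\big|F_{n,m}(x)-\Phi(x)\big|\le C\,\frac nm\,\frac1{\sigma_n},\qquad C=9.257 .$$ -/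

import Mathlib

open MeasureTheory ProbabilityTheory

/-- The set of distinct coupons seen in the first `t` draws `ξ 0 ω, …, ξ (t - 1) ω`, where the
coupons are labelled by `Fin n`. -/
def collected {Ω : Type*} {n : ℕ} (ξ : ℕ → Ω → Fin n) (t : ℕ) (ω : Ω) : Finset (Fin n) :=
  (Finset.range t).image (fun i => ξ i ω)

/-- The coupon collector's waiting time `W_{n,m}`: the number of draws needed to have, for the
first time, `n - m` distinct coupons (only `m` coupons are missing). On the event that this never
happens (it has probability zero for independent uniform draws) the value is `0`. -/
noncomputable def waitingTime {Ω : Type*} {n : ℕ} (ξ : ℕ → Ω → Fin n) (m : ℕ) (ω : Ω) : ℕ :=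
  sInf {t : ℕ | n - m ≤ (collected ξ t ω).card}

/-- The mean `μ_n = E W_{n,m}`. -/
noncomputable def waitingMean {Ω : Type*} [MeasurableSpace Ω] {n : ℕ} (P : Measure Ω)
    (ξ : ℕ → Ω → Fin n) (m : ℕ) : ℝ :=
  ∫ ω, (waitingTime ξ m ω : ℝ) ∂P

/-- The variance `σ_n² = Var W_{n,m}`. -/
noncomputable def waitingVar {Ω : Type*} [MeasurableSpace Ω] {n : ℕ} (P : Measure Ω)
    (ξ : ℕ → Ω → Fin n) (m : ℕ) : ℝ :=
  variance (fun ω => (waitingTime ξ m ω : ℝ)) P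

/-- The standard deviation `σ_n`. -/
noncomputable def waitingSd {Ω : Type*} [MeasurableSpace Ω] {n : ℕ} (P : Measure Ω)
    (ξ : ℕ → Ω → Fin n) (m : ℕ) : ℝ :=
  Real.sqrt (waitingVar P ξ m)

/-- The distribution function `F_{n,m}(x) = P((W_{n,m} - μ_n) / σ_n ≤ x)`. -/
noncomputable def standardizedCDF {Ω : Type*} [MeasurableSpace Ω] {n : ℕ} (P : Measure Ω)
    (ξ : ℕ → Ω → Fin n) (m : ℕ) (x : ℝ) : ℝ :=
  P.real {ω | ((waitingTime ξ m ω : ℝ) - waitingMean P ξ m) / waitingSd P ξ m ≤ x}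

/-- The standard normal distribution function `Φ`. -/
noncomputable def stdNormalCDF (x : ℝ) : ℝ :=
  (1 / Real.sqrt (2 * Real.pi)) * ∫ s in Set.Iic x, Real.exp (-s ^ 2 / 2)

/-! The law of the waiting time is that of a sum of independent geometric variables: once `i`
coupons are known, the next draw is new with probability `(n - i) / n`. This gives the mean and
variance, and turns the distance to `Φ` into a Berry–Esseen problem with explicit characteristic
functions.

Put `α = i / (n - i)`. The centred geometric variable has variance `α (1 + α)`, and its
characteristic function is the reciprocal of an elementary function, `invCenteredGeom α`. For `(1 +
α) |t| ≤ 1 / 2` the factor is at most `exp (-3/8 · variance · t²)` and differs from the Gaussian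
factor by a cubic term times the same exponential. Since `1 + α ≤ n / m` throughout, telescoping the
product (`norm_prod_sub_prod_le`) gives an error of order `σ² (n / m) |t|³ exp (-3/8 σ² t²)` for
`|t| ≤ m / (2n)`.

Scaling `W - μ` by `c = m / (2n)` turns this range into `|t| ≤ 1`, so Esseen's smoothing inequality
(`abs_cdf_sub_cdf_le`) is needed only at bandwidth one. It adds the integral of the error over `|t|`
to a multiple of the maximal density of the scaled Gaussian. Both are multiples of `1 / (c σ) = 2 (n
/ m) / σ`. -/

/-! ### The Fejér kernel: positivity, tails, total mass. -/

/-- The Fejér kernel of bandwidth one. -/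
noncomputable def fejer (x : ℝ) : ℝ :=
  (1 / (2 * Real.pi)) * ∫ t in (-1 : ℝ)..1, (1 - |t|) * Real.cos (t * x)

lemma integral_triangle_mul_cos {x : ℝ} (hx : x ≠ 0) :
    ∫ t in (-1 : ℝ)..1, (1 - |t|) * Real.cos (t * x) = 2 * (1 - Real.cos x) / x ^ 2 := by
  have hc : Continuous fun t : ℝ => (1 - |t|) * Real.cos (t * x) := by fun_prop
  rw [← intervalIntegral.integral_add_adjacent_intervals (b := 0)
    (hc.intervalIntegrable _ _) (hc.intervalIntegrable _ _)]
  -- The slope `s` is `1` on `[-1, 0]` and `-1` on `[0, 1]`, so one antiderivative serves both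
  -- halves of the triangle.
  have hd (s : ℝ) (t : ℝ) : HasDerivAt
      (fun t => (1 + s * t) * Real.sin (t * x) / x + s * Real.cos (t * x) / x ^ 2)
      ((1 + s * t) * Real.cos (t * x)) t := by
    have h1 : HasDerivAt (fun t : ℝ => t * x) x t := by simpa using (hasDerivAt_id t).mul_const x
    have h2 : HasDerivAt (fun t : ℝ => 1 + s * t) s t := by
      simpa using ((hasDerivAt_id t).const_mul s).const_add 1
    convert! ((h2.mul h1.sin).div_const x).add ((h1.cos.const_mul s).div_const (x ^ 2)) using 1
    field_simp
    ring
  have e1 : ∫ t in (-1 : ℝ)..0, (1 - |t|) * Real.cos (t * x)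
      = ∫ t in (-1 : ℝ)..0, (1 + 1 * t) * Real.cos (t * x) := by
    refine intervalIntegral.integral_congr fun t ht => ?_
    rw [Set.uIcc_of_le (by norm_num)] at ht
    simp only [abs_of_nonpos ht.2]
    ring
  have e2 : ∫ t in (0 : ℝ)..1, (1 - |t|) * Real.cos (t * x)
      = ∫ t in (0 : ℝ)..1, (1 + (-1) * t) * Real.cos (t * x) := by
    refine intervalIntegral.integral_congr fun t ht => ?_
    rw [Set.uIcc_of_le (by norm_num)] at ht
    simp only [abs_of_nonneg ht.1]
    ring
  rw [e1, e2, intervalIntegral.integral_eq_sub_of_hasDerivAt (fun t _ => hd 1 t)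
    (by apply Continuous.intervalIntegrable; fun_prop),
    intervalIntegral.integral_eq_sub_of_hasDerivAt (fun t _ => hd (-1) t)
    (by apply Continuous.intervalIntegrable; fun_prop)]
  simp
  field_simp
  ring

lemma fejer_eq {x : ℝ} (hx : x ≠ 0) : fejer x = (1 - Real.cos x) / (Real.pi * x ^ 2) := by
  rw [fejer, integral_triangle_mul_cos hx]
  field_simp

lemma fejer_neg (x : ℝ) : fejer (-x) = fejer x := by
  simp [fejer]

lemma continuous_fejer : Continuous fejer := by
  unfold fejer
  refine continuous_const.mul ?_
  apply intervalIntegral.continuous_parametric_intervalIntegral_of_continuous'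
  fun_prop

lemma fejer_nonneg (x : ℝ) : 0 ≤ fejer x := by
  rcases eq_or_ne x 0 with rfl | hx
  · refine mul_nonneg (by positivity) (intervalIntegral.integral_nonneg (by norm_num) fun t ht => ?_)
    simpa [abs_le] using ht
  · rw [fejer_eq hx]
    have := Real.cos_le_one x
    have := Real.pi_pos
    apply div_nonneg <;> [linarith; positivity]

lemma fejer_le {x : ℝ} (hx : x ≠ 0) : fejer x ≤ 2 / Real.pi * x⁻¹ ^ 2 := by
  rw [fejer_eq hx]
  have := Real.neg_one_le_cos x
  have h : (0 : ℝ) < x ^ 2 := by positivity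
  have : (1 - Real.cos x) / (Real.pi * x ^ 2) ≤ 2 / (Real.pi * x ^ 2) := by gcongr; linarith
  refine this.trans (le_of_eq ?_)
  field_simp

lemma integrableOn_inv_sq_Ioi {h : ℝ} (hh : 0 < h) :
    IntegrableOn (fun x : ℝ => x⁻¹ ^ 2) (Set.Ioi h) := by
  have := integrableOn_Ioi_rpow_of_lt (a := -2) (by norm_num) hh
  refine this.congr_fun (fun x hx => ?_) measurableSet_Ioi
  have hx0 : 0 < x := hh.trans hx
  simp only
  rw [Real.rpow_neg hx0.le]
  norm_cast
  simp

lemma integral_Ioi_inv_sq {h : ℝ} (hh : 0 < h) :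
    ∫ x in Set.Ioi h, x⁻¹ ^ 2 = 1 / h := by
  have := integral_Ioi_rpow_of_lt (a := -2) (by norm_num) hh
  rw [show (1 : ℝ) / h = -h ^ ((-2 : ℝ) + 1) / (-2 + 1) by
    norm_num [Real.rpow_neg hh.le], ← this]
  refine setIntegral_congr_fun measurableSet_Ioi (fun x hx => ?_)
  have hx0 : 0 < x := hh.trans hx
  rw [Real.rpow_neg hx0.le]
  norm_cast
  simp

lemma integrableOn_fejer_Ioi {h : ℝ} (hh : 0 < h) : IntegrableOn fejer (Set.Ioi h) := by
  refine Integrable.mono' ((integrableOn_inv_sq_Ioi hh).const_mul (2 / Real.pi))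
    continuous_fejer.aestronglyMeasurable ?_
  filter_upwards [ae_restrict_mem measurableSet_Ioi] with x hx
  rw [Real.norm_of_nonneg (fejer_nonneg x)]
  exact fejer_le (hh.trans hx).ne'

lemma integrable_fejer : Integrable fejer := by
  have h1 := integrableOn_fejer_Ioi one_pos
  have h2 : IntegrableOn fejer (Set.Iio (-1)) := by
    have := h1.comp_neg
    simpa [fejer_neg] using this
  have h3 : IntegrableOn fejer (Set.Icc (-1) 1) :=
    continuous_fejer.continuousOn.integrableOn_Icc
  rw [← integrableOn_univ]
  convert! (h2.union h3).union h1 using 1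
  ext x
  simp only [Set.mem_univ, Set.mem_union, Set.mem_Iio, Set.mem_Icc, Set.mem_Ioi, true_iff]
  by_cases hx : x < -1 <;> by_cases hy : 1 < x <;> simp_all

lemma integral_fejer_Ioi_le {h : ℝ} (hh : 0 < h) :
    ∫ x in Set.Ioi h, fejer x ≤ 2 / (Real.pi * h) := by
  have : ∫ x in Set.Ioi h, fejer x ≤ ∫ x in Set.Ioi h, 2 / Real.pi * x⁻¹ ^ 2 := by
    refine setIntegral_mono_on (integrableOn_fejer_Ioi hh)
      ((integrableOn_inv_sq_Ioi hh).const_mul _) measurableSet_Ioi fun x hx => ?_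
    exact fejer_le (hh.trans hx).ne'
  rw [integral_const_mul, integral_Ioi_inv_sq hh] at this
  refine this.trans (le_of_eq ?_)
  field_simp

-- The kernel is, up to scaling, the Fourier transform of the triangle function `ψ`. Fourier
-- inversion at `0` returns `ψ 0 = 1`.
open scoped FourierTransform in
lemma integral_fejer : ∫ x, fejer x = 1 := by
  set ψ : ℝ → ℂ := fun t => ((max 0 (1 - |t|) : ℝ) : ℂ) with hψ
  have hψc : Continuous ψ := by fun_prop
  have hsupp : ∀ t, t ∉ Set.Ioc (-1 : ℝ) 1 → ψ t = 0 := by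
    intro t ht
    have : 1 ≤ |t| := by
      by_contra! h
      rw [abs_lt] at h
      exact ht ⟨h.1, h.2.le⟩
    simp [hψ, this]
  have hψi : Integrable ψ := by
    apply hψc.integrable_of_hasCompactSupport
    refine HasCompactSupport.intro (K := Set.Icc (-1) 1) isCompact_Icc fun t ht => hsupp t ?_
    exact fun h => ht ⟨h.1.le, h.2⟩
  have hF (w : ℝ) : 𝓕 ψ w = ((2 * Real.pi * fejer (2 * Real.pi * w) : ℝ) : ℂ) := by
    have hint (c : ℝ) : Integrable fun t : ℝ => Complex.exp (c * t * Complex.I) * ψ t := by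
      refine hψi.mono (by fun_prop) (.of_forall fun t => ?_)
      rw [norm_mul, show (c : ℂ) * t * Complex.I = ((c * t : ℝ) : ℂ) * Complex.I by push_cast; ring,
        Complex.norm_exp_ofReal_mul_I, one_mul]
    set c := 2 * Real.pi * w with hc
    have e1 : 𝓕 ψ w = ∫ t : ℝ, Complex.exp (((-c : ℝ) : ℂ) * t * Complex.I) * ψ t := by
      rw [Real.fourier_real_eq_integral_exp_smul]
      congr with t
      rw [smul_eq_mul]
      congr 2
      push_cast [hc]
      ring
    have e2 : 𝓕 ψ w = ∫ t : ℝ, Complex.exp ((c : ℂ) * t * Complex.I) * ψ t := by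
      rw [e1, ← integral_neg_eq_self]
      congr with t
      simp [hψ]
    -- As `ψ` is even, the transform has both signs in its exponent; adding the two forms leaves a
    -- cosine.
    have e3 : 2 * 𝓕 ψ w = ∫ t : ℝ, ((2 * (max 0 (1 - |t|) * Real.cos (t * c)) : ℝ) : ℂ) := by
      rw [two_mul]
      nth_rw 1 [e1]
      rw [e2, ← integral_add (hint _) (hint _)]
      congr with t
      simp only [hψ]
      push_cast
      rw [Complex.cos]
      simp only [neg_mul]
      rw [mul_comm (t : ℂ) c]
      ring
    have e4 : ∫ t : ℝ, 2 * (max 0 (1 - |t|) * Real.cos (t * c)) = 2 * (2 * Real.pi * fejer c) := by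
      rw [integral_const_mul, ← setIntegral_eq_integral_of_forall_compl_eq_zero
        (s := Set.Ioc (-1 : ℝ) 1), ← intervalIntegral.integral_of_le (by norm_num)]
      · have : ∫ t in (-1 : ℝ)..1, max 0 (1 - |t|) * Real.cos (t * c)
            = ∫ t in (-1 : ℝ)..1, (1 - |t|) * Real.cos (t * c) := by
          refine intervalIntegral.integral_congr fun t ht => ?_
          rw [Set.uIcc_of_le (by norm_num)] at ht
          rw [max_eq_right (by have := abs_le.2 ht; linarith)]
        rw [this, fejer]
        field_simp
        simp_rw [mul_comm c]
      · intro t ht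
        have := hsupp t ht
        simp only [hψ, Complex.ofReal_eq_zero] at this
        rw [this, zero_mul]
    rw [integral_complex_ofReal, e4] at e3
    push_cast at e3 ⊢
    linear_combination e3 / 2
  have hFi : Integrable (𝓕 ψ) := by
    have : 𝓕 ψ = fun w => ((2 * Real.pi * fejer (2 * Real.pi * w) : ℝ) : ℂ) := funext hF
    rw [this]
    exact ((integrable_fejer.comp_mul_left' (by positivity)).const_mul _).ofReal
  have hinv := congrFun (hψc.fourierInv_fourier_eq hψi hFi) 0
  rw [Real.fourierInv_eq'] at hinv
  simp only [inner_zero_right, mul_zero, Complex.ofReal_zero, zero_mul, Complex.exp_zero,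
    one_smul, hF] at hinv
  rw [integral_complex_ofReal, integral_const_mul, Measure.integral_comp_mul_left] at hinv
  simp only [hψ, abs_zero, sub_zero, zero_le_one, sup_of_le_right] at hinv
  have := Complex.ofReal_injective hinv
  rw [abs_of_pos (by positivity), smul_eq_mul] at this
  field_simp at this
  exact this

/-! ### Smoothed distribution functions and characteristic functions. -/

/-- The Fourier transform of the indicator function of the interval between `y` and `w`. -/
noncomputable def intervalFourier (y w t : ℝ) : ℂ :=
  ∫ u in y..w, Complex.exp (((-(t * u) : ℝ) : ℂ) * Complex.I)

lemma continuous_intervalFourier (y w : ℝ) : Continuous (intervalFourier y w) := by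
  unfold intervalFourier
  apply intervalIntegral.continuous_parametric_intervalIntegral_of_continuous'
  fun_prop

/-- The bound does not involve `y` or `w`, which later permits `y → -∞`. Its singularity at `t = 0`
is cancelled by the factor `|t|` assumed in the estimate of the characteristic functions. -/
lemma norm_intervalFourier_le (y w : ℝ) {t : ℝ} (ht : t ≠ 0) :
    ‖intervalFourier y w t‖ ≤ 2 / |t| := by
  have hc : (-(t : ℂ) * Complex.I) ≠ 0 := by simp [ht]
  have : intervalFourier y w t = (Complex.exp (((-(t * w) : ℝ) : ℂ) * Complex.I)
      - Complex.exp (((-(t * y) : ℝ) : ℂ) * Complex.I)) / (-(t : ℂ) * Complex.I) := by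
    have := integral_exp_mul_complex (a := y) (b := w) hc
    rw [intervalFourier]
    convert this using 2
    · congr with u
      congr 1
      push_cast
      ring
    · congr 2 <;> · push_cast; ring
  rw [this, norm_div]
  have h1 : ‖-(t : ℂ) * Complex.I‖ = |t| := by simp
  rw [h1]
  gcongr
  refine (norm_sub_le _ _).trans ?_
  rw [Complex.norm_exp_ofReal_mul_I, Complex.norm_exp_ofReal_mul_I]
  norm_num

lemma norm_intervalFourier_le' (y w t : ℝ) : ‖intervalFourier y w t‖ ≤ |w - y| := by
  have := intervalIntegral.norm_integral_le_of_norm_le_const (a := y) (b := w) (C := 1)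
    (f := fun u => Complex.exp (((-(t * u) : ℝ) : ℂ) * Complex.I)) (fun u _ => by
      rw [Complex.norm_exp_ofReal_mul_I])
  rwa [one_mul] at this

lemma re_exp_mul_intervalFourier (y w x t : ℝ) :
    (Complex.exp (((t * x : ℝ) : ℂ) * Complex.I) * intervalFourier y w t).re
      = ∫ u in y..w, Real.cos (t * (u - x)) := by
  rw [intervalFourier, ← intervalIntegral.integral_const_mul]
  have h2 := Complex.reCLM.intervalIntegral_comp_comm (μ := volume) (a := y) (b := w)
    (f := fun u => Complex.exp (((t * x : ℝ) : ℂ) * Complex.I) *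
      Complex.exp (((-(t * u) : ℝ) : ℂ) * Complex.I))
      (by apply Continuous.intervalIntegrable; fun_prop)
  simp only [Complex.reCLM_apply] at h2
  rw [← h2]
  congr with u
  rw [← Complex.exp_add, ← add_mul, ← Complex.ofReal_add, Complex.exp_ofReal_mul_I_re,
    ← Real.cos_neg]
  congr 1
  ring

lemma integral_fejer_sub (y w x : ℝ) :
    ∫ u in y..w, fejer (u - x) = (1 / (2 * Real.pi)) * ∫ t in (-1 : ℝ)..1, (1 - |t|) *
      (Complex.exp (((t * x : ℝ) : ℂ) * Complex.I) * intervalFourier y w t).re := by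
  simp_rw [re_exp_mul_intervalFourier, ← intervalIntegral.integral_const_mul, fejer,
    ← intervalIntegral.integral_const_mul]
  apply intervalIntegral_intervalIntegral_swap
  refine (ContinuousOn.integrableOn_compact (K := Set.uIcc y w ×ˢ Set.uIcc (-1 : ℝ) 1)
    (isCompact_uIcc.prod isCompact_uIcc) ?_).mono_set
    (Set.prod_mono Set.uIoc_subset_uIcc Set.uIoc_subset_uIcc)
  apply Continuous.continuousOn
  unfold Function.uncurry
  fun_prop

/-- The left side is the mass of `(y, w]` under `μ` convolved with the Fejér law. The Fourier
integral of the kernel has compact support, so only `charFun μ` on `[-1, 1]` enters. -/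
lemma integral_integral_fejer_eq_charFun (μ : Measure ℝ) [IsProbabilityMeasure μ] (y w : ℝ) :
    ∫ x, (∫ u in y..w, fejer (u - x)) ∂μ = (1 / (2 * Real.pi)) * ∫ t in (-1 : ℝ)..1, (1 - |t|) *
      (charFun μ t * intervalFourier y w t).re := by
  simp_rw [integral_fejer_sub]
  rw [integral_const_mul]
  congr 1
  simp_rw [intervalIntegral.integral_of_le (show (-1 : ℝ) ≤ 1 by norm_num)]
  have hc := continuous_intervalFourier y w
  rw [integral_integral_swap]
  · congr with t
    rw [integral_const_mul]
    congr 1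
    rw [charFun_apply_real, ← integral_mul_const]
    have hi : Integrable (fun x : ℝ => Complex.exp (t * x * Complex.I) * intervalFourier y w t) μ := by
      refine Integrable.mul_const ?_ _
      refine Integrable.of_bound (C := 1) (by fun_prop) (.of_forall fun x => ?_)
      rw [← Complex.ofReal_mul, Complex.norm_exp_ofReal_mul_I]
    have := Complex.reCLM.integral_comp_comm hi
    simp only [Complex.reCLM_apply] at this
    rw [← this]
    simp
  · refine Integrable.of_bound (C := |w - y|) ?_ ?_
    · apply Continuous.aestronglyMeasurable
      unfold Function.uncurry
      fun_prop
    · rw [Measure.ae_prod_iff_ae_ae]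
      · refine .of_forall fun x => ?_
        filter_upwards [ae_restrict_mem measurableSet_Ioc] with t ht
        simp only [Function.uncurry]
        rw [norm_mul, ← one_mul |w - y|]
        refine mul_le_mul ?_ ?_ (norm_nonneg _) zero_le_one
        · have := abs_le.2 ⟨ht.1.le, ht.2⟩
          have := abs_nonneg t
          rw [Real.norm_eq_abs, abs_le]
          constructor <;> linarith
        · refine (Complex.abs_re_le_norm _).trans ?_
          rw [norm_mul, Complex.norm_exp_ofReal_mul_I, one_mul]
          exact norm_intervalFourier_le' y w t
      · apply measurableSet_le
        · apply Continuous.measurable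
          unfold Function.uncurry
          fun_prop
        · exact measurable_const

/-- The same double integral, now integrated over `x` first; comparison with
`integral_integral_fejer_eq_charFun` links distribution functions to characteristic functions. -/
lemma integral_integral_fejer_eq_cdf (μ : Measure ℝ) [IsProbabilityMeasure μ] {y w : ℝ}
    (h : y ≤ w) :
    ∫ x, (∫ u in y..w, fejer (u - x)) ∂μ = ∫ s, fejer s * (cdf μ (w - s) - cdf μ (y - s)) := by
  have e1 (x : ℝ) : ∫ u in y..w, fejer (u - x)
      = ∫ s, fejer s * (Set.Ioc y w).indicator 1 (s + x) := by
    rw [intervalIntegral.integral_of_le h, ← integral_indicator measurableSet_Ioc,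
      ← integral_add_right_eq_self _ x]
    congr with s
    by_cases hs : s + x ∈ Set.Ioc y w <;> simp [hs]
  simp_rw [e1]
  rw [integral_integral_swap]
  · congr with s
    rw [integral_const_mul]
    congr 1
    have : (fun x : ℝ => (Set.Ioc y w).indicator (1 : ℝ → ℝ) (s + x))
        = (Set.Ioc (y - s) (w - s)).indicator 1 := by
      ext x
      simp only [Set.indicator, Set.mem_Ioc]
      congr 1
      simp only [sub_lt_iff_lt_add', le_sub_iff_add_le']
    rw [this, integral_indicator_one measurableSet_Ioc, cdf_eq_real, cdf_eq_real,
      ← Set.Iic_sdiff_Iic, measureReal_sdiff (by gcongr) measurableSet_Iic]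
  · have : Integrable (fun z : ℝ × ℝ => (1 : ℝ) * fejer z.2) (μ.prod volume) :=
      Integrable.mul_prod (integrable_const 1) integrable_fejer
    refine this.mono ?_ (.of_forall fun z => ?_)
    · unfold Function.uncurry
      refine AEStronglyMeasurable.mul ?_ ?_
      · exact (continuous_fejer.comp continuous_snd).aestronglyMeasurable
      · apply Measurable.aestronglyMeasurable
        exact (measurable_one.indicator measurableSet_Ioc).comp (by fun_prop)
    · simp only [Function.uncurry, norm_mul, one_mul]
      apply mul_le_of_le_one_right (norm_nonneg _)
      refine (norm_indicator_le_norm_self _ _).trans ?_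
      simp

lemma integrable_fejer_mul {D : ℝ → ℝ} (hD : Measurable D) {η : ℝ} (hη : ∀ x, |D x| ≤ η) (w : ℝ) :
    Integrable fun s => fejer s * D (w - s) := by
  refine (integrable_fejer.mul_const η).mono ?_ (.of_forall fun s => ?_)
  · exact continuous_fejer.aestronglyMeasurable.mul
      (hD.comp (by fun_prop)).aestronglyMeasurable
  · rw [norm_mul, norm_mul]
    gcongr
    exact (hη _).trans (le_abs_self η)

lemma abs_cdf_sub_cdf_le_one (μ ν : Measure ℝ) (x : ℝ) : |cdf μ x - cdf ν x| ≤ 1 := by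
  have := cdf_nonneg μ x
  have := cdf_nonneg ν x
  have := cdf_le_one μ x
  have := cdf_le_one ν x
  rw [abs_le]
  constructor <;> linarith

lemma abs_integral_fejer_mul_increment_le (μ ν : Measure ℝ) [IsProbabilityMeasure μ]
    [IsProbabilityMeasure ν] {b : ℝ → ℝ} (hb : IntervalIntegrable b volume (-1) 1)
    (hbd : ∀ t, |t| ≤ 1 → ‖charFun μ t - charFun ν t‖ ≤ |t| * b t) {y w : ℝ} (h : y ≤ w) :
    |∫ s, fejer s * ((cdf μ (w - s) - cdf ν (w - s)) - (cdf μ (y - s) - cdf ν (y - s)))|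
      ≤ (1 / Real.pi) * ∫ t in (-1 : ℝ)..1, b t := by
  have hint (ρ : Measure ℝ) : Integrable fun s => fejer s * (cdf ρ (w - s) - cdf ρ (y - s)) := by
    have (z : ℝ) := integrable_fejer_mul (monotone_cdf ρ).measurable (η := 1)
      (fun x => by rw [abs_of_nonneg (cdf_nonneg ρ x)]; exact cdf_le_one ρ x) z
    simp_rw [mul_sub]
    exact (this w).sub (this y)
  have hc := continuous_intervalFourier y w
  have hci (ρ : Measure ℝ) [IsProbabilityMeasure ρ] : IntervalIntegrable
      (fun t => (1 - |t|) * (charFun ρ t * intervalFourier y w t).re) volume (-1) 1 := by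
    apply Continuous.intervalIntegrable
    have := continuous_charFun (μ := ρ)
    fun_prop
  have e : ∫ s, fejer s * ((cdf μ (w - s) - cdf ν (w - s)) - (cdf μ (y - s) - cdf ν (y - s)))
      = (1 / (2 * Real.pi)) * ∫ t in (-1 : ℝ)..1, (1 - |t|) *
        ((charFun μ t - charFun ν t) * intervalFourier y w t).re := by
    have e1 := integral_integral_fejer_eq_charFun μ y w
    have e2 := integral_integral_fejer_eq_charFun ν y w
    rw [integral_integral_fejer_eq_cdf _ h] at e1 e2
    calc _ = ∫ s, (fejer s * (cdf μ (w - s) - cdf μ (y - s))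
          - fejer s * (cdf ν (w - s) - cdf ν (y - s))) := by
          congr with s
          ring
      _ = _ := by
          rw [integral_sub (hint μ) (hint ν), e1, e2, ← mul_sub,
            ← intervalIntegral.integral_sub (hci μ) (hci ν)]
          congr 2 with t
          rw [sub_mul (charFun μ t), Complex.sub_re]
          ring
  rw [e, abs_mul, abs_of_nonneg (by positivity)]
  have hle : |∫ t in (-1 : ℝ)..1, (1 - |t|) *
      ((charFun μ t - charFun ν t) * intervalFourier y w t).re| ≤ ∫ t in (-1 : ℝ)..1, 2 * b t := by
    rw [← Real.norm_eq_abs]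
    refine intervalIntegral.norm_integral_le_of_norm_le (by norm_num) ?_ (hb.const_mul 2)
    have h0 : ∀ᵐ t : ℝ, t ≠ 0 := by
      rw [ae_iff]
      simp
    filter_upwards [h0] with t ht hm
    have ht1 : |t| ≤ 1 := abs_le.2 ⟨hm.1.le, hm.2⟩
    have ht0 := abs_nonneg t
    rw [Real.norm_eq_abs, abs_mul, abs_of_nonneg (by linarith : 0 ≤ 1 - |t|)]
    have hre := (Complex.abs_re_le_norm ((charFun μ t - charFun ν t) * intervalFourier y w t))
    rw [norm_mul] at hre
    have hp : ‖charFun μ t - charFun ν t‖ * ‖intervalFourier y w t‖ ≤ |t| * b t * (2 / |t|) :=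
      mul_le_mul (hbd t ht1) (norm_intervalFourier_le y w ht) (norm_nonneg _)
        ((norm_nonneg _).trans (hbd t ht1))
    have htp : 0 < |t| := abs_pos.2 ht
    calc _ ≤ 1 * (|t| * b t * (2 / |t|)) :=
          mul_le_mul (by linarith) (hre.trans hp) (abs_nonneg _) zero_le_one
      _ = _ := by field_simp
  rw [intervalIntegral.integral_const_mul] at hle
  calc _ ≤ 1 / (2 * Real.pi) * (2 * ∫ t in (-1 : ℝ)..1, b t) := by gcongr
    _ = _ := by field_simp

/-- The bound for increments is uniform in `y`. As `y → -∞` the smoothed difference at `y` vanishes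
by dominated convergence, with majorant `fejer`. -/
lemma abs_integral_fejer_mul_cdf_sub_le (μ ν : Measure ℝ) [IsProbabilityMeasure μ]
    [IsProbabilityMeasure ν] {b : ℝ → ℝ} (hb : IntervalIntegrable b volume (-1) 1)
    (hbd : ∀ t, |t| ≤ 1 → ‖charFun μ t - charFun ν t‖ ≤ |t| * b t) (w : ℝ) :
    |∫ s, fejer s * (cdf μ (w - s) - cdf ν (w - s))|
      ≤ (1 / Real.pi) * ∫ t in (-1 : ℝ)..1, b t := by
  have hm : Measurable fun x => cdf μ x - cdf ν x :=
    (monotone_cdf μ).measurable.sub (monotone_cdf ν).measurable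
  have hi := integrable_fejer_mul hm (abs_cdf_sub_cdf_le_one μ ν)
  have hlim : Filter.Tendsto (fun y => ∫ s, fejer s * (cdf μ (y - s) - cdf ν (y - s)))
      Filter.atBot (nhds 0) := by
    have := tendsto_integral_filter_of_dominated_convergence (μ := volume) (l := Filter.atBot)
      (F := fun y s => fejer s * (cdf μ (y - s) - cdf ν (y - s))) (f := fun _ => 0) fejer
      (.of_forall fun y => (hi y).aestronglyMeasurable)
      (.of_forall fun y => .of_forall fun s => by
        rw [norm_mul, Real.norm_of_nonneg (fejer_nonneg s)]
        exact mul_le_of_le_one_right (fejer_nonneg s) (abs_cdf_sub_cdf_le_one μ ν _))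
      integrable_fejer (.of_forall fun s => by
        have h1 : Filter.Tendsto (fun y : ℝ => y - s) Filter.atBot Filter.atBot :=
          Filter.tendsto_atBot_add_const_right _ (-s) Filter.tendsto_id
        have := (((tendsto_cdf_atBot μ).comp h1).sub ((tendsto_cdf_atBot ν).comp h1)).const_mul
          (fejer s)
        simpa using this)
    simpa using this
  have hlim2 := (hlim.const_sub (∫ s, fejer s * (cdf μ (w - s) - cdf ν (w - s)))).abs
  rw [sub_zero] at hlim2
  refine le_of_tendsto hlim2 ?_
  filter_upwards [Filter.eventually_le_atBot w] with y hy
  have := abs_integral_fejer_mul_increment_le μ ν hb hbd hy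
  simp_rw [mul_sub (fejer _) (cdf μ (w - _) - cdf ν (w - _))] at this
  rwa [integral_sub (hi w) (hi y)] at this

/-! ### Esseen's smoothing inequality. -/

/-- The half-width `16 / π` makes each tail bound `2 / (π h)` equal to `1 / 8`. -/
lemma three_quarters_le_integral_fejer :
    3 / 4 ≤ ∫ s in Set.Ioc (-(16 / Real.pi)) (16 / Real.pi), fejer s := by
  have hh : 0 < 16 / Real.pi := by positivity
  have h1 := integral_fejer_Ioi_le hh
  have h2 : ∫ s in Set.Iic (-(16 / Real.pi)), fejer s = ∫ s in Set.Ioi (16 / Real.pi), fejer s := by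
    rw [← integral_comp_neg_Ioi]
    simp_rw [fejer_neg]
  have h3 := intervalIntegral.integral_Iic_add_Ioi (b := 16 / Real.pi)
    (f := fejer) integrable_fejer.integrableOn integrable_fejer.integrableOn
  have h4 := intervalIntegral.integral_Iic_sub_Iic (a := -(16 / Real.pi)) (b := 16 / Real.pi)
    (f := fejer) integrable_fejer.integrableOn integrable_fejer.integrableOn
  rw [intervalIntegral.integral_of_le (by linarith)] at h4
  rw [integral_fejer] at h3
  have : 2 / (Real.pi * (16 / Real.pi)) = 1 / 8 := by field_simp; norm_num
  linarith

/-- A large value `D x` cannot drop quickly to the right of `x`, so the average centred at `x + h`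
is large too. On the window the integral is at least `(D x - h L) M`, the linear part vanishing by
evenness of the kernel; outside it is at least `-η (1 - M)`. With `M ≥ 3 / 4` this is solved for `D
x`. -/
lemma le_of_abs_integral_fejer_mul_le {D : ℝ → ℝ} (hD : Measurable D) {η L B : ℝ}
    (hη : ∀ x, |D x| ≤ η) (hlip : ∀ x y, x ≤ y → D x - L * (y - x) ≤ D y)
    (hB : ∀ w, |∫ s, fejer s * D (w - s)| ≤ B) (x : ℝ) :
    D x ≤ η / 3 + 4 / 3 * B + 16 / Real.pi * L := by
  set h := 16 / Real.pi with hh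
  have hpos : 0 < h := by positivity
  have hη0 : 0 ≤ η := (abs_nonneg _).trans (hη 0)
  have hB0 : 0 ≤ B := (abs_nonneg _).trans (hB 0)
  -- If `D x ≤ h L` the claim is immediate; otherwise `D x - h L ≥ 0`, which is what allows `M` to
  -- be replaced by `3 / 4`.
  rcases le_total (D x) (h * L) with hx | hx
  · linarith
  set S := Set.Ioc (-h) h with hS
  set M := ∫ s in S, fejer s with hM
  have hM1 : 3 / 4 ≤ M := three_quarters_le_integral_fejer
  have hcompl : ∫ s in Sᶜ, fejer s = 1 - M := by
    have := integral_add_compl (s := S) measurableSet_Ioc integrable_fejer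
    rw [integral_fejer] at this
    linarith
  have hodd : ∫ s in S, s * fejer s = 0 := by
    rw [hS, ← intervalIntegral.integral_of_le (by linarith)]
    have := intervalIntegral.integral_comp_neg (a := -h) (b := h) fun s => s * fejer s
    simp only [fejer_neg, neg_mul, neg_neg, intervalIntegral.integral_neg] at this
    linarith
  have hi := integrable_fejer_mul hD hη (x + h)
  have hs : IntegrableOn (fun s => s * fejer s) S := by
    have : Continuous fun s => s * fejer s := continuous_id.mul continuous_fejer
    exact this.continuousOn.integrableOn_Icc.mono_set Set.Ioc_subset_Icc_self
  have hin : (D x - h * L) * M ≤ ∫ s in S, fejer s * D (x + h - s) := by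
    have : ∫ s in S, ((D x - h * L) * fejer s + L * (s * fejer s)) = (D x - h * L) * M := by
      rw [integral_add (integrable_fejer.integrableOn.const_mul _) (hs.const_mul _),
        integral_const_mul, integral_const_mul, hodd, mul_zero, add_zero]
    rw [← this]
    refine setIntegral_mono_on ((integrable_fejer.integrableOn.const_mul _).add (hs.const_mul _))
      hi.integrableOn measurableSet_Ioc fun s hs => ?_
    have := mul_le_mul_of_nonneg_left (hlip x (x + h - s) (by linarith [hs.2])) (fejer_nonneg s)
    linarith
  have hout : -η * (1 - M) ≤ ∫ s in Sᶜ, fejer s * D (x + h - s) := by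
    rw [← hcompl, ← integral_const_mul]
    refine setIntegral_mono_on (integrable_fejer.integrableOn.const_mul _)
      hi.integrableOn measurableSet_Ioc.compl fun s hs => ?_
    have := mul_le_mul_of_nonneg_left (abs_le.1 (hη (x + h - s))).1 (fejer_nonneg s)
    linarith
  have htot := integral_add_compl (s := S) measurableSet_Ioc hi
  have hBx := (abs_le.1 (hB (x + h))).2
  nlinarith [mul_nonneg (sub_nonneg.2 hx) (sub_nonneg.2 hM1), mul_nonneg hη0 (sub_nonneg.2 hM1)]

/-- **Esseen's smoothing inequality** at bandwidth one. -/
theorem abs_cdf_sub_cdf_le (μ ν : Measure ℝ) [IsProbabilityMeasure μ]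
    [IsProbabilityMeasure ν] {b : ℝ → ℝ} (hb : IntervalIntegrable b volume (-1) 1)
    (hbd : ∀ t, |t| ≤ 1 → ‖charFun μ t - charFun ν t‖ ≤ |t| * b t) {L : ℝ}
    (hlip : ∀ x y, x ≤ y → cdf ν y - cdf ν x ≤ L * (y - x)) (x : ℝ) :
    |cdf μ x - cdf ν x| ≤ 2 / Real.pi * (∫ t in (-1 : ℝ)..1, b t) + 24 / Real.pi * L := by
  set B := (1 / Real.pi) * ∫ t in (-1 : ℝ)..1, b t with hBdef
  set D : ℝ → ℝ := fun x => cdf μ x - cdf ν x with hD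
  have hm : Measurable D := (monotone_cdf μ).measurable.sub (monotone_cdf ν).measurable
  have hbdd : BddAbove (Set.range fun x => |D x|) := by
    refine ⟨1, ?_⟩
    rintro _ ⟨x, rfl⟩
    exact abs_cdf_sub_cdf_le_one μ ν x
  set η := ⨆ x, |D x| with hη
  have hle (x : ℝ) : |D x| ≤ η := le_ciSup hbdd x
  have hB := abs_integral_fejer_mul_cdf_sub_le μ ν hb hbd
  have hup := le_of_abs_integral_fejer_mul_le hm hle (fun x y hxy => by
    have := hlip x y hxy
    have := monotone_cdf μ hxy
    simp only [hD]
    linarith) hB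
  -- The reflection `x ↦ -D (-x)` obeys the same one-sided Lipschitz condition, so the upper bound
  -- applied to it bounds `D` from below.
  have hdown := le_of_abs_integral_fejer_mul_le (D := fun x => -D (-x)) (by fun_prop)
    (fun x => by rw [abs_neg]; exact hle _) (fun x y hxy => by
    have := hlip (-y) (-x) (by linarith)
    have := monotone_cdf μ (neg_le_neg hxy)
    simp only [hD]
    linarith) (B := B) (fun w => by
      have e : ∫ s, fejer s * -D (-(w - s)) = -∫ s, fejer s * D (-w - s) := by
        rw [← integral_neg, ← integral_neg_eq_self]
        congr with s
        rw [fejer_neg, show -(w - -s) = -w - s by ring]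
        ring
      rw [e, abs_neg]
      exact hB (-w))
  -- The supremum `η` is finite, so `η / 3` can be absorbed on the left, at the cost of the factor
  -- `3 / 2`.
  have hfin : η ≤ η / 3 + 4 / 3 * B + 16 / Real.pi * L := by
    refine ciSup_le fun x => abs_le.2 ⟨?_, hup x⟩
    have := hdown (-x)
    rw [neg_neg] at this
    linarith
  have h24 : 24 / Real.pi * L = 3 / 2 * (16 / Real.pi * L) := by ring
  have h2 : 2 / Real.pi * (∫ t in (-1 : ℝ)..1, b t) = 2 * B := by
    rw [hBdef]
    ring
  rw [h24, h2]
  linarith [hle x]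

/-! ### Characteristic functions of centred geometric variables. -/

/-- Follows from `g t = ∫ s in 0..1, t • g' (s * t)`, a form that treats both signs of `t` at once.
-/
lemma norm_le_of_norm_deriv_le_pow {g g' : ℝ → ℂ} (hg : ∀ t, HasDerivAt g (g' t) t)
    (hc : Continuous g') (h0 : g 0 = 0) {C : ℝ} {k : ℕ} (hC : ∀ t, ‖g' t‖ ≤ C * |t| ^ k) (t : ℝ) :
    ‖g t‖ ≤ C * |t| ^ (k + 1) / (k + 1) := by
  have hd (s : ℝ) : HasDerivAt (fun s => g (s * t)) (t • g' (s * t)) s := by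
    have h1 : HasDerivAt (fun s : ℝ => s * t) t s := by simpa using (hasDerivAt_id s).mul_const t
    exact (hg (s * t)).scomp s h1
  have hi := intervalIntegral.integral_eq_sub_of_hasDerivAt (a := 0) (b := 1) (fun s _ => hd s)
    (by apply Continuous.intervalIntegrable; fun_prop)
  simp only [one_mul, zero_mul, h0, sub_zero] at hi
  rw [← hi]
  calc _ ≤ ∫ s in (0 : ℝ)..1, C * |t| ^ (k + 1) * s ^ k := by
        refine intervalIntegral.norm_integral_le_of_norm_le zero_le_one
          (.of_forall fun s hs => ?_) (by apply Continuous.intervalIntegrable; fun_prop)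
        rw [norm_smul, Real.norm_eq_abs]
        calc _ ≤ |t| * (C * |s * t| ^ k) := by gcongr; exact hC _
          _ = _ := by
            rw [abs_mul, abs_of_pos hs.1]
            ring
    _ = _ := by
        rw [intervalIntegral.integral_const_mul, integral_pow]
        simp
        ring

lemma norm_exp_mul_I_sub_one_le (t : ℝ) : ‖Complex.exp (t * Complex.I) - 1‖ ≤ |t| := by
  rw [mul_comm]
  exact Real.norm_exp_I_mul_ofReal_sub_one_le

lemma hasDerivAt_exp_mul_I (c t : ℝ) : HasDerivAt (fun t : ℝ => Complex.exp ((c * t : ℝ) * Complex.I))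
    (Complex.exp ((c * t : ℝ) * Complex.I) * (c * Complex.I)) t := by
  have h1 : HasDerivAt (fun t : ℝ => ((c * t : ℝ) : ℂ) * Complex.I) (c * Complex.I) t := by
    have : HasDerivAt (fun t : ℝ => c * t) c t := by simpa using (hasDerivAt_id t).const_mul c
    exact this.ofReal_comp.mul_const _
  exact h1.cexp

lemma norm_exp_mul_I_sub_one_sub_le (t : ℝ) :
    ‖Complex.exp (t * Complex.I) - 1 - t * Complex.I‖ ≤ t ^ 2 / 2 := by
  have := norm_le_of_norm_deriv_le_pow (C := 1) (k := 1)
    (g := fun t : ℝ => Complex.exp (t * Complex.I) - 1 - t * Complex.I)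
    (g' := fun t : ℝ => Complex.exp (t * Complex.I) * Complex.I - Complex.I)
    (fun t => by
      have h1 := hasDerivAt_exp_mul_I 1 t
      simp only [one_mul, Complex.ofReal_one] at h1
      have h2 : HasDerivAt (fun t : ℝ => (t : ℂ) * Complex.I) (1 * Complex.I) t :=
        ((hasDerivAt_id t).ofReal_comp).mul_const _
      rw [one_mul] at h2
      exact (h1.sub_const 1).sub h2) (by fun_prop) (by simp) (fun t => by
      have : Complex.exp (t * Complex.I) * Complex.I - Complex.I
        = (Complex.exp (t * Complex.I) - 1) * Complex.I := by ring
      rw [this, norm_mul, Complex.norm_I, mul_one, one_mul, pow_one]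
      exact norm_exp_mul_I_sub_one_le t) t
  norm_num at this
  exact this

/-- The reciprocal of the characteristic function of a centred geometric variable
with mean `1 + α`. -/
noncomputable def invCenteredGeom (α t : ℝ) : ℂ :=
  Complex.exp ((α * t : ℝ) * Complex.I) * (1 - α * (Complex.exp (t * Complex.I) - 1))

/-- Centring makes the two terms of the product rule combine into a multiple of `exp (t I) - 1`. The
first-order term is thus absent, and one further expansion suffices for a cubic remainder. -/
lemma hasDerivAt_invCenteredGeom (α t : ℝ) : HasDerivAt (invCenteredGeom α)
    (-(α * (1 + α) * Complex.I) * (Complex.exp ((α * t : ℝ) * Complex.I) *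
      (Complex.exp (t * Complex.I) - 1))) t := by
  have h1 := hasDerivAt_exp_mul_I 1 t
  simp only [one_mul, Complex.ofReal_one] at h1
  have h2 := (hasDerivAt_exp_mul_I α t).mul (((h1.sub_const 1).const_mul (α : ℂ)).const_sub 1)
  refine h2.congr_deriv ?_
  ring

lemma norm_invCenteredGeom_sub_le {α : ℝ} (hα : 0 ≤ α) (t : ℝ) :
    ‖invCenteredGeom α t - 1 - (α * (1 + α) * t ^ 2 / 2 : ℝ)‖
      ≤ α * (1 + α) * (1 + α) * |t| ^ 3 / 3 := by
  have := norm_le_of_norm_deriv_le_pow (C := α * (1 + α) * (1 + α)) (k := 2)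
    (g := fun t : ℝ => invCenteredGeom α t - 1 - (α * (1 + α) * t ^ 2 / 2 : ℝ))
    (g' := fun t : ℝ => -(α * (1 + α) * Complex.I) * (Complex.exp ((α * t : ℝ) * Complex.I) *
      (Complex.exp (t * Complex.I) - 1)) - (α * (1 + α) * t : ℝ))
    (fun t => by
      have h2 : HasDerivAt (fun t : ℝ => α * (1 + α) * t ^ 2 / 2) (α * (1 + α) * t) t := by
        refine (((hasDerivAt_pow 2 t).const_mul (α * (1 + α))).div_const 2).congr_deriv ?_
        simp
        ring
      exact ((hasDerivAt_invCenteredGeom α t).sub_const 1).sub h2.ofReal_comp)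
    (by fun_prop) (by simp [invCenteredGeom]) (fun t => by
      have e : -(α * (1 + α) * Complex.I) * (Complex.exp ((α * t : ℝ) * Complex.I) *
          (Complex.exp (t * Complex.I) - 1)) - (α * (1 + α) * t : ℝ)
          = ((α * (1 + α) : ℝ) : ℂ) * (-Complex.I * ((Complex.exp ((α * t : ℝ) * Complex.I) - 1) *
            (Complex.exp (t * Complex.I) - 1)
            + (Complex.exp (t * Complex.I) - 1 - t * Complex.I))) := by
        push_cast
        linear_combination (-(α : ℂ) * (1 + α) * t) * Complex.I_sq
      have h3 : ‖(Complex.exp ((α * t : ℝ) * Complex.I) - 1) * (Complex.exp (t * Complex.I) - 1)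
          + (Complex.exp (t * Complex.I) - 1 - t * Complex.I)‖ ≤ (1 + α) * |t| ^ 2 := by
        refine (norm_add_le _ _).trans ?_
        rw [norm_mul]
        have := mul_le_mul (norm_exp_mul_I_sub_one_le (α * t)) (norm_exp_mul_I_sub_one_le t)
          (norm_nonneg _) (abs_nonneg _)
        rw [abs_mul, abs_of_nonneg hα] at this
        have h4 := norm_exp_mul_I_sub_one_sub_le t
        rw [← sq_abs] at h4
        nlinarith [sq_nonneg |t|]
      have hv : 0 ≤ α * (1 + α) := by positivity
      rw [e, norm_mul, norm_mul, norm_neg, Complex.norm_I, one_mul, Complex.norm_real,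
        Real.norm_of_nonneg hv, mul_assoc (α * (1 + α))]
      gcongr) t
  norm_num at this ⊢
  exact this

lemma norm_sq_invCenteredGeom (α t : ℝ) :
    ‖invCenteredGeom α t‖ ^ 2 = 1 + 2 * (α * (1 + α)) * (1 - Real.cos t) := by
  rw [invCenteredGeom, norm_mul, Complex.norm_exp_ofReal_mul_I, one_mul, Complex.sq_norm,
    Complex.normSq_apply]
  simp only [Complex.sub_re, Complex.sub_im, Complex.mul_re, Complex.mul_im, Complex.ofReal_re,
    Complex.ofReal_im, Complex.exp_ofReal_mul_I_re, Complex.exp_ofReal_mul_I_im, Complex.one_re,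
    Complex.one_im]
  linear_combination α ^ 2 * Real.sin_sq_add_cos_sq t

/-- With `x = α (1 + α) t² ≤ 1 / 4`, the exact formula for the squared norm and the quartic cosine
bound give at least `1 + x (1 - 5/48 t²)`, while `exp (3/4 x) ≤ 1 + 3/4 x + (3/4 x)²`. Taking `3 /
8` instead of the Gaussian `1 / 2` leaves room for both errors. -/
lemma exp_le_norm_invCenteredGeom {α t : ℝ} (hα : 0 ≤ α) (ht : (1 + α) * |t| ≤ 1 / 2) :
    Real.exp (3 / 8 * (α * (1 + α) * t ^ 2)) ≤ ‖invCenteredGeom α t‖ := by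
  have ht1 : |t| ≤ 1 / 2 := by nlinarith [abs_nonneg t]
  have hcos := (abs_le.1 (Real.cos_bound (ht1.trans (by norm_num)))).2
  have ht2 : t ^ 2 ≤ 1 / 4 := by
    rw [← sq_abs]
    nlinarith [abs_nonneg t]
  have h4 : |t| ^ 4 = t ^ 2 * t ^ 2 := by rw [← sq_abs t]; ring
  rw [h4] at hcos
  set x := α * (1 + α) * t ^ 2 with hx
  have hv : 0 ≤ α * (1 + α) := by positivity
  have hx0 : 0 ≤ x := by positivity
  have hx1 : x ≤ 1 / 4 := by
    have : ((1 + α) * |t|) ^ 2 ≤ (1 / 2) ^ 2 := by gcongr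
    rw [mul_pow, sq_abs] at this
    nlinarith [sq_nonneg t]
  have hy := (abs_le.1 (Real.abs_exp_sub_one_sub_id_le (x := 3 / 4 * x)
    (by rw [abs_of_nonneg (by positivity)]; linarith))).2
  rw [← pow_le_pow_iff_left₀ (Real.exp_pos _).le (norm_nonneg _) two_ne_zero,
    norm_sq_invCenteredGeom, ← Real.exp_nat_mul]
  have e : ((2 : ℕ) : ℝ) * (3 / 8 * x) = 3 / 4 * x := by push_cast; ring
  rw [e]
  have h5 : α * (1 + α) * (2 * (t ^ 2 / 2 - t ^ 2 * t ^ 2 * (5 / 96)))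
      ≤ α * (1 + α) * (2 * (1 - Real.cos t)) := by
    refine mul_le_mul_of_nonneg_left ?_ hv
    linarith
  have h6 : α * (1 + α) * (2 * (t ^ 2 / 2 - t ^ 2 * t ^ 2 * (5 / 96)))
      = x * (1 - 5 / 48 * t ^ 2) := by rw [hx]; ring
  nlinarith [mul_nonneg hx0 (sub_nonneg.2 ht2), mul_nonneg hx0 (sub_nonneg.2 hx1)]

lemma norm_inv_invCenteredGeom_le {α t : ℝ} (hα : 0 ≤ α) (ht : (1 + α) * |t| ≤ 1 / 2) :
    ‖(invCenteredGeom α t)⁻¹‖ ≤ Real.exp (-(3 / 8 * (α * (1 + α) * t ^ 2))) := by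
  rw [norm_inv, Real.exp_neg]
  exact inv_anti₀ (Real.exp_pos _) (exp_le_norm_invCenteredGeom hα ht)

/-- The denominators are compared first: `invCenteredGeom α t` and `exp y` both equal `1 + y` up to
cubic errors with constants `1/3` and `1/8`, together below `1/2`. Of the two reciprocals, one
supplies the exponential decay and the other is bounded by `1`. -/
lemma norm_inv_invCenteredGeom_sub_exp_le {α t : ℝ} (hα : 0 ≤ α) (ht : (1 + α) * |t| ≤ 1 / 2) :
    ‖(invCenteredGeom α t)⁻¹ - (Real.exp (-(α * (1 + α) * t ^ 2 / 2)) : ℝ)‖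
      ≤ α * (1 + α) * (1 + α) * |t| ^ 3 / 2 * Real.exp (-(3 / 8 * (α * (1 + α) * t ^ 2))) := by
  set v := α * (1 + α) with hv
  have hv0 : 0 ≤ v := by positivity
  set y := v * t ^ 2 / 2 with hy
  have hy0 : 0 ≤ y := by positivity
  have habs := abs_nonneg t
  have hvt : v * |t| ≤ (1 + α) / 2 := by nlinarith
  have hy1 : y ≤ 1 := by
    rw [hy, ← sq_abs]
    nlinarith
  have hu0 : invCenteredGeom α t ≠ 0 := by
    rw [← norm_pos_iff]
    exact (Real.exp_pos _).trans_le (exp_le_norm_invCenteredGeom hα ht)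
  have hexp : ‖(Real.exp y : ℂ) - 1 - (y : ℝ)‖ ≤ v * (1 + α) * |t| ^ 3 / 8 := by
    have h1 := Real.abs_exp_sub_one_sub_id_le (x := y) (by rwa [abs_of_nonneg hy0])
    have h2 : ‖(Real.exp y : ℂ) - 1 - (y : ℝ)‖ = |Real.exp y - 1 - y| := by
      rw [← Real.norm_eq_abs, ← Complex.norm_real]
      push_cast
      rfl
    rw [h2]
    refine h1.trans ?_
    have : y ^ 2 = v * |t| ^ 3 * (v * |t|) / 4 := by
      rw [hy, ← sq_abs t]
      ring
    rw [this]
    have : v * |t| ^ 3 * (v * |t|) ≤ v * |t| ^ 3 * ((1 + α) / 2) := by gcongr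
    linarith
  have hu := norm_invCenteredGeom_sub_le hα t
  rw [← hv, ← hy] at hu
  have hdiff : ‖invCenteredGeom α t - (Real.exp y : ℂ)‖ ≤ v * (1 + α) * |t| ^ 3 / 2 := by
    have e : invCenteredGeom α t - (Real.exp y : ℂ)
      = (invCenteredGeom α t - 1 - (y : ℝ)) - ((Real.exp y : ℂ) - 1 - (y : ℝ)) := by ring
    rw [e]
    refine (norm_sub_le _ _).trans ?_
    have : 0 ≤ v * (1 + α) * |t| ^ 3 := by positivity
    linarith
  have hE0 : (Real.exp y : ℂ) ≠ 0 := by exact_mod_cast (Real.exp_pos y).ne'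
  have e : (invCenteredGeom α t)⁻¹ - (Real.exp (-y) : ℝ)
      = -((invCenteredGeom α t - (Real.exp y : ℂ)) * (invCenteredGeom α t)⁻¹
        * ((Real.exp (-y) : ℝ) : ℂ)) := by
    rw [Real.exp_neg]
    push_cast at hE0 ⊢
    field_simp
    ring
  have hEle : ‖((Real.exp (-y) : ℝ) : ℂ)‖ ≤ 1 := by
    rw [Complex.norm_real, Real.norm_of_nonneg (Real.exp_pos _).le]
    exact Real.exp_le_one_iff.2 (by linarith)
  rw [e, norm_neg, norm_mul, norm_mul]
  have hn := norm_inv_invCenteredGeom_le hα ht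
  calc _ ≤ v * (1 + α) * |t| ^ 3 / 2 * Real.exp (-(3 / 8 * (v * t ^ 2))) * 1 := by gcongr
    _ = _ := mul_one _

/-- Telescoping: factors are exchanged one at a time. Because the difference at `i` also carries
`exp (-w i)`, no decay is lost at the exchanged factor. -/
lemma norm_prod_sub_prod_le {ι : Type*} (s : Finset ι) {f g : ι → ℂ} {d w : ι → ℝ}
    (hf : ∀ i ∈ s, ‖f i‖ ≤ Real.exp (-w i)) (hg : ∀ i ∈ s, ‖g i‖ ≤ Real.exp (-w i))
    (hfg : ∀ i ∈ s, ‖f i - g i‖ ≤ d i * Real.exp (-w i)) :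
    ‖∏ i ∈ s, f i - ∏ i ∈ s, g i‖ ≤ (∑ i ∈ s, d i) * Real.exp (-∑ i ∈ s, w i) := by
  classical
  induction s using Finset.induction_on with
  | empty => simp
  | insert a s ha ih =>
    have ih := ih (fun i hi => hf i (Finset.mem_insert_of_mem hi))
      (fun i hi => hg i (Finset.mem_insert_of_mem hi))
      (fun i hi => hfg i (Finset.mem_insert_of_mem hi))
    have hgp : ‖∏ i ∈ s, g i‖ ≤ Real.exp (-∑ i ∈ s, w i) := by
      rw [norm_prod, ← Finset.sum_neg_distrib, Real.exp_sum]
      exact Finset.prod_le_prod (fun i _ => norm_nonneg _)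
        fun i hi => hg i (Finset.mem_insert_of_mem hi)
    rw [Finset.prod_insert ha, Finset.prod_insert ha, Finset.sum_insert ha, Finset.sum_insert ha,
      neg_add, Real.exp_add]
    have e : f a * ∏ i ∈ s, f i - g a * ∏ i ∈ s, g i
        = (f a - g a) * ∏ i ∈ s, g i + f a * (∏ i ∈ s, f i - ∏ i ∈ s, g i) := by ring
    rw [e]
    refine (norm_add_le _ _).trans ?_
    rw [norm_mul, norm_mul]
    have ha' := Finset.mem_insert_self a s
    calc _ ≤ d a * Real.exp (-w a) * Real.exp (-∑ i ∈ s, w i)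
          + Real.exp (-w a) * ((∑ i ∈ s, d i) * Real.exp (-∑ i ∈ s, w i)) := by
          gcongr
          · exact (norm_nonneg _).trans (hfg a ha')
          · exact hfg a ha'
          · exact hf a ha'
      _ = _ := by ring

lemma norm_prod_invCenteredGeom_sub_exp_le {ι : Type*} (s : Finset ι) {α : ι → ℝ} {a t : ℝ}
    (hα : ∀ i ∈ s, 0 ≤ α i) (ha : ∀ i ∈ s, 1 + α i ≤ a) (ht : a * |t| ≤ 1 / 2) {V : ℝ}
    (hV : ∑ i ∈ s, α i * (1 + α i) = V) :
    ‖∏ i ∈ s, (invCenteredGeom (α i) t)⁻¹ - (Real.exp (-(V * t ^ 2 / 2)) : ℝ)‖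
      ≤ V * a * |t| ^ 3 / 2 * Real.exp (-(3 / 8 * (V * t ^ 2))) := by
  have hti (i) (hi : i ∈ s) : (1 + α i) * |t| ≤ 1 / 2 :=
    (mul_le_mul_of_nonneg_right (ha i hi) (abs_nonneg t)).trans ht
  have hv (i) (hi : i ∈ s) : 0 ≤ α i * (1 + α i) := by
    have := hα i hi
    positivity
  have h := norm_prod_sub_prod_le s (f := fun i => (invCenteredGeom (α i) t)⁻¹)
    (g := fun i => (Real.exp (-(α i * (1 + α i) * t ^ 2 / 2)) : ℝ))
    (d := fun i => α i * (1 + α i) * (a * |t| ^ 3 / 2))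
    (w := fun i => α i * (1 + α i) * (3 / 8 * t ^ 2))
    (fun i hi => by
      refine (norm_inv_invCenteredGeom_le (hα i hi) (hti i hi)).trans (le_of_eq ?_)
      congr 1
      ring)
    (fun i hi => by
      rw [Complex.norm_real, Real.norm_of_nonneg (Real.exp_pos _).le]
      gcongr
      nlinarith [mul_nonneg (hv i hi) (sq_nonneg t)])
    (fun i hi => by
      refine (norm_inv_invCenteredGeom_sub_exp_le (hα i hi) (hti i hi)).trans ?_
      have h1 := mul_le_mul_of_nonneg_left (ha i hi) (hv i hi)
      have h2 := mul_le_mul_of_nonneg_right h1 (by positivity : 0 ≤ |t| ^ 3 / 2)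
      refine mul_le_mul ?_ (Real.exp_le_exp.2 ?_) (Real.exp_pos _).le ?_
      · linarith
      · linarith
      · have := (hv i hi)
        have : 0 ≤ a := (by linarith [hα i hi] : (0 : ℝ) ≤ 1 + α i).trans (ha i hi)
        positivity)
  rw [← Complex.ofReal_prod, ← Real.exp_sum, Finset.sum_neg_distrib] at h
  simp_rw [← Finset.sum_div] at h
  rw [← Finset.sum_mul, ← Finset.sum_mul, ← Finset.sum_mul, hV] at h
  refine h.trans (le_of_eq ?_)
  congr 1
  · ring
  · congr 1
    ring

/-! ### The generating function of the waiting time. -/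

/-- Summing the recurrence bounds the partial sums of `‖y t‖` and then gives a linear equation for
the sum. Absolute summability is part of the conclusion because `y` serves as the forcing term `β`
at the next level. -/
lemma summable_and_hasSum_of_recurrence {y β : ℕ → ℂ} {γ B : ℂ} (hγ : ‖γ‖ < 1) {y0 : ℂ}
    (h0 : y 0 = y0) (hrec : ∀ t, y (t + 1) = γ * y t + β t) (hβ : Summable fun t => ‖β t‖)
    (hB : HasSum β B) : (Summable fun t => ‖y t‖) ∧ HasSum y ((y0 + B) / (1 - γ)) := by
  have hs : Summable fun t => ‖y t‖ := by
    refine summable_of_sum_range_le (c := (‖y0‖ + ∑' t, ‖β t‖) / (1 - ‖γ‖))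
      (fun t => norm_nonneg _) fun T => ?_
    have hpos : 0 < 1 - ‖γ‖ := by linarith
    have hle : ∑ t ∈ Finset.range (T + 1), ‖y t‖
        ≤ ‖y0‖ + ‖γ‖ * (∑ t ∈ Finset.range T, ‖y t‖) + ∑' t, ‖β t‖ := by
      rw [Finset.sum_range_succ', h0, Finset.mul_sum]
      have h1 : ∑ t ∈ Finset.range T, ‖y (t + 1)‖
          ≤ ∑ t ∈ Finset.range T, (‖γ‖ * ‖y t‖ + ‖β t‖) := by
        refine Finset.sum_le_sum fun t _ => ?_
        rw [hrec, ← norm_mul]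
        exact norm_add_le _ _
      rw [Finset.sum_add_distrib] at h1
      have h2 := hβ.sum_le_tsum (Finset.range T) (fun _ _ => norm_nonneg _)
      linarith
    have hmono : ∑ t ∈ Finset.range T, ‖y t‖ ≤ ∑ t ∈ Finset.range (T + 1), ‖y t‖ := by
      rw [Finset.sum_range_succ]
      linarith [norm_nonneg (y T)]
    rw [le_div_iff₀ hpos]
    linarith
  refine ⟨hs, ?_⟩
  have hy : Summable y := hs.of_norm
  have h1 : ∑' t, y t = y0 + (γ * ∑' t, y t + B) := by
    conv_lhs => rw [hy.tsum_eq_zero_add, h0]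
    congr 1
    simp_rw [hrec]
    rw [(hy.mul_left γ).tsum_add hB.summable, tsum_mul_left, hB.tsum_eq]
  have hne : (1 : ℂ) - γ ≠ 0 := by
    intro h
    rw [← sub_eq_zero.1 h] at hγ
    simp at hγ
  have h2 : (y0 + B) / (1 - γ) = ∑' t, y t := by
    rw [div_eq_iff hne]
    linear_combination -h1
  rw [h2]
  exact hy.hasSum

section Collector

variable {Ω : Type*} {n : ℕ} {ξ : ℕ → Ω → Fin n}

lemma collected_succ (t : ℕ) (ω : Ω) :
    collected ξ (t + 1) ω = insert (ξ t ω) (collected ξ t ω) := by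
  simp [collected, Finset.range_add_one]

lemma card_collected_succ (t : ℕ) (ω : Ω) : (collected ξ (t + 1) ω).card
    = (collected ξ t ω).card + if ξ t ω ∈ collected ξ t ω then 0 else 1 := by
  rw [collected_succ]
  split_ifs with h
  · rw [Finset.insert_eq_of_mem h, add_zero]
  · rw [Finset.card_insert_of_notMem h]

lemma collected_mono (ω : Ω) : Monotone fun t => collected ξ t ω := fun s t h => by
  exact Finset.image_subset_image (Finset.range_mono h)

/-- The number of coupons grows by at most one per draw, so the level `n - m` is entered from `n - m
- 1`. The default value `0` of `sInf ∅` cannot interfere with a value `t + 1`. -/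
lemma waitingTime_eq_succ_iff {m : ℕ} (h : m < n) (t : ℕ) (ω : Ω) :
    waitingTime ξ m ω = t + 1 ↔
      (collected ξ t ω).card = n - m - 1 ∧ ξ t ω ∉ collected ξ t ω := by
  have hmono {s u : ℕ} (hsu : s ≤ u) : (collected ξ s ω).card ≤ (collected ξ u ω).card :=
    Finset.card_le_card (collected_mono ω hsu)
  have hstep := card_collected_succ (ξ := ξ) t ω
  constructor
  · intro hw
    have hmem : n - m ≤ (collected ξ (t + 1) ω).card := by
      rw [← hw]
      refine Nat.sInf_mem (s := {t : ℕ | n - m ≤ (collected ξ t ω).card}) ?_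
      exact Nat.nonempty_of_pos_sInf (by unfold waitingTime at hw; omega)
    have hnot : ¬ n - m ≤ (collected ξ t ω).card := fun hle => by
      have : waitingTime ξ m ω ≤ t := Nat.sInf_le hle
      omega
    split_ifs at hstep with hin
    · omega
    · exact ⟨by omega, hin⟩
  · rintro ⟨hc, hnot⟩
    rw [if_neg hnot] at hstep
    refine le_antisymm (Nat.sInf_le (show n - m ≤ _ by omega)) ?_
    by_contra! hlt
    have hmem : n - m ≤ (collected ξ (waitingTime ξ m ω) ω).card :=
      Nat.sInf_mem (s := {t : ℕ | n - m ≤ (collected ξ t ω).card})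
        ⟨t + 1, show n - m ≤ _ by omega⟩
    have := hmono (Nat.lt_succ_iff.1 hlt)
    omega

variable [MeasurableSpace Ω]

lemma measurableSet_collected_mem (hmeas : ∀ i, Measurable (ξ i)) (t : ℕ)
    (Q : Finset (Fin n) → Prop) : MeasurableSet {ω | Q (collected ξ t ω)} := by
  have : {ω | Q (collected ξ t ω)} = (fun ω (i : Finset.range t) => ξ i ω) ⁻¹'
      {x : Finset.range t → Fin n | Q (Finset.univ.image x)} := by
    ext ω
    simp only [Set.mem_ofPred_eq, Set.mem_preimage]
    have : collected ξ t ω = Finset.univ.image fun i : Finset.range t => ξ i ω := by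
      ext k
      simp [collected]
    rw [this]
  rw [this]
  have hpi : Measurable fun ω (i : Finset.range t) => ξ i ω :=
    measurable_pi_lambda _ fun i => hmeas i
  exact hpi MeasurableSet.of_discrete

lemma measurableSet_card_and_mem (hmeas : ∀ i, Measurable (ξ i)) (t : ℕ)
    (Q : Finset (Fin n) → Prop) :
    MeasurableSet {ω | Q (collected ξ t ω) ∧ ξ t ω ∈ collected ξ t ω} := by
  have : {ω | Q (collected ξ t ω) ∧ ξ t ω ∈ collected ξ t ω}
      = ⋃ k : Fin n, {ω | Q (collected ξ t ω) ∧ k ∈ collected ξ t ω} ∩ ξ t ⁻¹' {k} := by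
    ext ω
    simp
  rw [this]
  exact MeasurableSet.iUnion fun k =>
    (measurableSet_collected_mem hmeas t fun A => Q A ∧ k ∈ A).inter
      (hmeas t (MeasurableSet.of_discrete))

lemma measurable_waitingTime (hmeas : ∀ i, Measurable (ξ i)) {m : ℕ} (h : m < n) :
    Measurable (waitingTime ξ m) := by
  have hsucc (t : ℕ) : MeasurableSet (waitingTime ξ m ⁻¹' {t + 1}) := by
    have : waitingTime ξ m ⁻¹' {t + 1} = {ω | (collected ξ t ω).card = n - m - 1} \
        {ω | (collected ξ t ω).card = n - m - 1 ∧ ξ t ω ∈ collected ξ t ω} := by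
      ext ω
      simp only [Set.mem_preimage, Set.mem_singleton_iff, waitingTime_eq_succ_iff h, Set.mem_sdiff,
        Set.mem_ofPred_eq]
      tauto
    rw [this]
    exact (measurableSet_collected_mem hmeas t fun A => A.card = n - m - 1).diff
      (measurableSet_card_and_mem hmeas t fun A => A.card = n - m - 1)
  refine measurable_to_countable' fun k => ?_
  cases k with
  | succ t => exact hsucc t
  | zero =>
    -- The value `0` includes the event that the level is never reached; it is handled as the
    -- complement of the positive values.
    have : waitingTime ξ m ⁻¹' {0} = (⋃ t, waitingTime ξ m ⁻¹' {t + 1})ᶜ := by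
      ext ω
      simp only [Set.mem_preimage, Set.mem_singleton_iff, Set.mem_compl_iff, Set.mem_iUnion,
        not_exists]
      constructor
      · intro h0 t
        omega
      · intro hall
        by_contra hne
        exact hall (waitingTime ξ m ω - 1) (by omega)
    rw [this]
    exact (MeasurableSet.iUnion hsucc).compl

variable {P : Measure Ω} [IsProbabilityMeasure P]

/-- The collected set is a function of the draws before `t`, hence independent of draw `t`. -/
lemma measureReal_collected_eq_and_mem (hmeas : ∀ i, Measurable (ξ i)) (hindep : iIndepFun ξ P)
    (hunif : ∀ (i : ℕ) (k : Fin n), P.real {ω | ξ i ω = k} = 1 / (n : ℝ)) (t : ℕ)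
    (A : Finset (Fin n)) :
    P.real {ω | collected ξ t ω = A ∧ ξ t ω ∈ A} = P.real {ω | collected ξ t ω = A} * (A.card / n) := by
  have hA : P.real {ω | ξ t ω ∈ A} = A.card / n := by
    have : {ω | ξ t ω ∈ A} = ⋃ k ∈ A, {ω | ξ t ω = k} := by
      ext ω
      simp
    rw [this, measureReal_biUnion_finset]
    · simp [hunif]
      ring
    · intro i _ j _ hij
      exact Set.disjoint_left.2 fun ω h1 h2 => hij (h1.symm.trans h2)
    · intro k _
      exact hmeas t (MeasurableSet.of_discrete (s := {k}))
  have hind := hindep.indepFun_finset (Finset.range t) {t} (by simp) hmeas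
  have h := hind.measure_inter_preimage_eq_mul
    {x | Finset.univ.image x = A} {x | x ⟨t, by simp⟩ ∈ A} MeasurableSet.of_discrete
    MeasurableSet.of_discrete
  have e (ω : Ω) : collected ξ t ω = Finset.univ.image fun i : Finset.range t => ξ i ω := by
    ext k
    simp [collected]
  rw [← hA]
  simp_rw [e, measureReal_def, ← ENNReal.toReal_mul]
  congr 1

lemma measureReal_card_and_mem (hmeas : ∀ i, Measurable (ξ i)) (hindep : iIndepFun ξ P)
    (hunif : ∀ (i : ℕ) (k : Fin n), P.real {ω | ξ i ω = k} = 1 / (n : ℝ)) (t j : ℕ) :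
    P.real {ω | (collected ξ t ω).card = j ∧ ξ t ω ∈ collected ξ t ω}
      = P.real {ω | (collected ξ t ω).card = j} * (j / n) := by
  have e1 : {ω | (collected ξ t ω).card = j ∧ ξ t ω ∈ collected ξ t ω}
      = ⋃ A ∈ Finset.univ.filter fun A : Finset (Fin n) => A.card = j,
        {ω | collected ξ t ω = A ∧ ξ t ω ∈ A} := by
    ext ω
    simp
  have e2 : {ω | (collected ξ t ω).card = j}
      = ⋃ A ∈ Finset.univ.filter fun A : Finset (Fin n) => A.card = j,
        {ω | collected ξ t ω = A} := by
    ext ω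
    simp
  rw [e1, e2, measureReal_biUnion_finset, measureReal_biUnion_finset, Finset.sum_mul]
  · refine Finset.sum_congr rfl fun A hA => ?_
    rw [measureReal_collected_eq_and_mem hmeas hindep hunif, (Finset.mem_filter.1 hA).2]
  · intro A _ B _ hAB
    exact Set.disjoint_left.2 fun ω h1 h2 => hAB (h1.symm.trans h2)
  · exact fun A _ => measurableSet_collected_mem hmeas t fun B => B = A
  · intro A _ B _ hAB
    exact Set.disjoint_left.2 fun ω h1 h2 => hAB (h1.1.symm.trans h2.1)
  · intro A _
    have : {ω | collected ξ t ω = A ∧ ξ t ω ∈ A}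
      = {ω | collected ξ t ω = A ∧ ξ t ω ∈ collected ξ t ω} := by
      ext ω
      constructor <;> · rintro ⟨rfl, h⟩; exact ⟨rfl, h⟩
    rw [this]
    exact measurableSet_card_and_mem hmeas t fun B => B = A

lemma measureReal_card_and_notMem (hn : 0 < n) (hmeas : ∀ i, Measurable (ξ i))
    (hindep : iIndepFun ξ P)
    (hunif : ∀ (i : ℕ) (k : Fin n), P.real {ω | ξ i ω = k} = 1 / (n : ℝ)) (t j : ℕ) :
    P.real {ω | (collected ξ t ω).card = j ∧ ξ t ω ∉ collected ξ t ω}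
      = P.real {ω | (collected ξ t ω).card = j} * ((n - j) / n) := by
  have e : {ω | (collected ξ t ω).card = j ∧ ξ t ω ∉ collected ξ t ω}
      = {ω | (collected ξ t ω).card = j} \
        {ω | (collected ξ t ω).card = j ∧ ξ t ω ∈ collected ξ t ω} := by
    ext ω
    simp only [Set.mem_ofPred_eq, Set.mem_sdiff]
    tauto
  rw [e, measureReal_sdiff
    (show {ω | (collected ξ t ω).card = j ∧ ξ t ω ∈ collected ξ t ω}
      ⊆ {ω | (collected ξ t ω).card = j} from fun ω h => h.1)
    (measurableSet_card_and_mem hmeas t fun A => A.card = j),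
    measureReal_card_and_mem hmeas hindep hunif]
  field_simp

lemma measureReal_card_succ (hn : 0 < n) (hmeas : ∀ i, Measurable (ξ i)) (hindep : iIndepFun ξ P)
    (hunif : ∀ (i : ℕ) (k : Fin n), P.real {ω | ξ i ω = k} = 1 / (n : ℝ)) (t j : ℕ) :
    P.real {ω | (collected ξ (t + 1) ω).card = j + 1}
      = P.real {ω | (collected ξ t ω).card = j + 1} * ((j + 1) / n)
        + P.real {ω | (collected ξ t ω).card = j} * ((n - j) / n) := by
  have e : {ω | (collected ξ (t + 1) ω).card = j + 1}
      = {ω | (collected ξ t ω).card = j + 1 ∧ ξ t ω ∈ collected ξ t ω} ∪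
        {ω | (collected ξ t ω).card = j ∧ ξ t ω ∉ collected ξ t ω} := by
    ext ω
    simp only [Set.mem_ofPred_eq, Set.mem_union, card_collected_succ]
    split_ifs with h <;> simp [h]
  rw [e, measureReal_union' ?_ (measurableSet_card_and_mem hmeas t fun A => A.card = j + 1),
    measureReal_card_and_mem hmeas hindep hunif,
    measureReal_card_and_notMem hn hmeas hindep hunif]
  · push_cast
    rfl
  · exact Set.disjoint_left.2 fun ω h1 h2 => h2.2 h1.2

/-- Level `j + 1` is kept with probability `(j + 1) / n` or entered from `j` with probability `(n -
j) / n`. Multiplied by `z ^ t`, this is the recurrence of `summable_and_hasSum_of_recurrence`, and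
each level contributes one geometric factor. As `j < n`, the ratio stays below `1` even on the unit
circle. -/
lemma hasSum_measureReal_card (hn : 0 < n) (hmeas : ∀ i, Measurable (ξ i)) (hindep : iIndepFun ξ P)
    (hunif : ∀ (i : ℕ) (k : Fin n), P.real {ω | ξ i ω = k} = 1 / (n : ℝ)) {z : ℂ} (hz : ‖z‖ ≤ 1)
    {j : ℕ} (hj : j < n) :
    (Summable fun t => ‖(P.real {ω | (collected ξ t ω).card = j} : ℂ) * z ^ t‖) ∧
    HasSum (fun t => (P.real {ω | (collected ξ t ω).card = j} : ℂ) * z ^ t)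
      ((∏ i ∈ Finset.range j, (z * ((n - i) / n) / (1 - z * (i / n)))) / (1 - z * (j / n))) := by
  have hn' : (0 : ℝ) < n := by exact_mod_cast hn
  induction j with
  | zero =>
    have h0 (t : ℕ) : (P.real {ω | (collected ξ t ω).card = 0} : ℂ) * z ^ t
        = if t = 0 then 1 else 0 := by
      cases t with
      | zero => simp [collected]
      | succ t =>
        have : {ω | (collected ξ (t + 1) ω).card = 0} = ∅ := by
          ext ω
          simp [collected]
        rw [this]
        simp
    simp_rw [h0]
    refine ⟨summable_of_ne_finset_zero (s := {0}) fun t ht => ?_, ?_⟩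
    · simp at ht
      simp [ht]
    · simpa using hasSum_ite_eq 0 (1 : ℂ)
  | succ j ih =>
    obtain ⟨hs, hB⟩ := ih (by omega)
    have hγ : ‖z * (((j + 1 : ℕ) : ℂ) / n)‖ < 1 := by
      rw [norm_mul, norm_div, Complex.norm_natCast, Complex.norm_natCast]
      have : ((j + 1 : ℕ) : ℝ) / n < 1 := by
        rw [div_lt_one hn']
        exact_mod_cast hj
      have h0 : 0 ≤ ((j + 1 : ℕ) : ℝ) / n := by positivity
      nlinarith [norm_nonneg z]
    have := summable_and_hasSum_of_recurrence hγ (y0 := 0)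
      (y := fun t => (P.real {ω | (collected ξ t ω).card = j + 1} : ℂ) * z ^ t)
      (β := fun t => (z * ((n - j) / n)) *
        ((P.real {ω | (collected ξ t ω).card = j} : ℂ) * z ^ t)) (by simp [collected])
      (fun t => by
        rw [measureReal_card_succ hn hmeas hindep hunif]
        push_cast
        ring) (by
        simp_rw [norm_mul (z * ((n - j : ℂ) / n))]
        exact hs.mul_left _) (hB.mul_left _)
    refine ⟨this.1, ?_⟩
    convert! this.2 using 2
    rw [Finset.prod_range_succ]
    ring

lemma hasSum_measureReal_waitingTime_succ (hmeas : ∀ i, Measurable (ξ i)) (hindep : iIndepFun ξ P)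
    (hunif : ∀ (i : ℕ) (k : Fin n), P.real {ω | ξ i ω = k} = 1 / (n : ℝ)) {m : ℕ} (hm : 0 < m)
    (h : m < n) {z : ℂ} (hz : ‖z‖ ≤ 1) :
    HasSum (fun t => (P.real {ω | waitingTime ξ m ω = t + 1} : ℂ) * z ^ (t + 1))
      (∏ i ∈ Finset.range (n - m), (z * ((n - i) / n) / (1 - z * (i / n)))) := by
  have hn : 0 < n := by omega
  have hs := (hasSum_measureReal_card hn hmeas hindep hunif hz
    (show n - m - 1 < n by omega)).2.mul_left (z * ((n - (n - m - 1 : ℕ)) / n))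
  have e : ∏ i ∈ Finset.range (n - m), (z * ((n - i) / n) / (1 - z * (i / n)))
      = z * ((n - (n - m - 1 : ℕ)) / n) *
        ((∏ i ∈ Finset.range (n - m - 1), (z * ((n - i) / n) / (1 - z * (i / n))))
          / (1 - z * ((n - m - 1 : ℕ) / n))) := by
    obtain ⟨N, hN⟩ : ∃ N, n - m = N + 1 := ⟨n - m - 1, by omega⟩
    rw [hN, Finset.prod_range_succ, Nat.add_sub_cancel]
    ring
  rw [e]
  convert! hs using 2 with t
  simp_rw [waitingTime_eq_succ_iff h]
  rw [measureReal_card_and_notMem hn hmeas hindep hunif]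
  push_cast
  ring

lemma hasSum_measureReal_waitingTime_eq (hmeas : ∀ i, Measurable (ξ i)) {m : ℕ} (h : m < n) :
    HasSum (fun k => P.real {ω | waitingTime ξ m ω = k}) 1 := by
  have hW := measurable_waitingTime hmeas h
  have : IsProbabilityMeasure (P.map (waitingTime ξ m)) :=
    Measure.isProbabilityMeasure_map hW.aemeasurable
  have h1 := integral_countable (μ := P.map (waitingTime ξ m)) (f := fun _ => (1 : ℝ))
    (integrable_const _)
  have hs : Summable fun k => P.real {ω | waitingTime ξ m ω = k} := by
    refine summable_of_sum_le (c := 1) (fun _ => measureReal_nonneg) fun u => ?_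
    rw [← measureReal_biUnion_finset]
    · exact measureReal_le_one
    · intro i _ j _ hij
      exact Set.disjoint_left.2 fun ω h1 h2 => hij (h1.symm.trans h2)
    · intro k _
      exact hW (MeasurableSet.of_discrete (s := {k}))
  have e (k : ℕ) : (P.map (waitingTime ξ m)).real {k} = P.real {ω | waitingTime ξ m ω = k} := by
    rw [map_measureReal_apply hW (MeasurableSet.of_discrete)]
    rfl
  simp only [integral_const, probReal_univ, smul_eq_mul, mul_one, e] at h1
  rw [h1]
  exact hs.hasSum

lemma hasSum_measureReal_waitingTime (hmeas : ∀ i, Measurable (ξ i)) (hindep : iIndepFun ξ P)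
    (hunif : ∀ (i : ℕ) (k : Fin n), P.real {ω | ξ i ω = k} = 1 / (n : ℝ)) {m : ℕ} (hm : 0 < m)
    (h : m < n) {z : ℂ} (hz : ‖z‖ ≤ 1) :
    HasSum (fun k => (P.real {ω | waitingTime ξ m ω = k} : ℂ) * z ^ k)
      (∏ i ∈ Finset.range (n - m), (z * ((n - i) / n) / (1 - z * (i / n)))) := by
  have hn : (n : ℂ) ≠ 0 := by
    have : n ≠ 0 := by omega
    exact_mod_cast this
  -- At `z = 1` the product is `1`: the positive values carry all the mass. Hence the value `0`, and
  -- with it the event of never finishing, is null.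
  have h1 := hasSum_measureReal_waitingTime_succ hmeas hindep hunif hm h (z := 1) (by simp)
  have hprod : ∏ i ∈ Finset.range (n - m), ((1 : ℂ) * ((n - i) / n) / (1 - 1 * (i / n))) = 1 := by
    refine Finset.prod_eq_one fun i hi => ?_
    rw [Finset.mem_range] at hi
    have h2 : (n : ℂ) - i ≠ 0 := by
      have : (n : ℂ) ≠ i := by
        have : n ≠ i := by omega
        exact_mod_cast this
      exact sub_ne_zero.2 this
    field_simp
  rw [hprod] at h1
  simp only [one_pow, mul_one] at h1
  have h1' : HasSum (fun t => P.real {ω | waitingTime ξ m ω = t + 1}) 1 := by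
    simpa using Complex.reCLM.hasSum h1
  have h0 : P.real {ω | waitingTime ξ m ω = 0} = 0 := by
    have h2 := hasSum_measureReal_waitingTime_eq (P := P) hmeas h
    have h3 := h2.summable.tsum_eq_zero_add
    rw [h2.tsum_eq, h1'.tsum_eq] at h3
    linarith
  rw [← hasSum_nat_add_iff' 1]
  simpa [h0] using hasSum_measureReal_waitingTime_succ hmeas hindep hunif hm h hz

lemma charFun_map_waitingTime (hmeas : ∀ i, Measurable (ξ i)) (hindep : iIndepFun ξ P)
    (hunif : ∀ (i : ℕ) (k : Fin n), P.real {ω | ξ i ω = k} = 1 / (n : ℝ)) {m : ℕ} (hm : 0 < m)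
    (h : m < n) (t : ℝ) :
    charFun (P.map fun ω => (waitingTime ξ m ω : ℝ)) t = ∏ i ∈ Finset.range (n - m),
      (Complex.exp (t * Complex.I) * ((n - i) / n) / (1 - Complex.exp (t * Complex.I) * (i / n))) := by
  have hW := measurable_waitingTime hmeas h
  have hWr : Measurable fun ω => (waitingTime ξ m ω : ℝ) := measurable_from_nat.comp hW
  have : IsProbabilityMeasure (P.map (waitingTime ξ m)) :=
    Measure.isProbabilityMeasure_map hW.aemeasurable
  rw [← (hasSum_measureReal_waitingTime hmeas hindep hunif hm h
    (Complex.norm_exp_ofReal_mul_I t).le).tsum_eq, charFun_apply_real,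
    integral_map hWr.aemeasurable (by fun_prop)]
  rw [← integral_map (f := fun k : ℕ => Complex.exp (t * (k : ℝ) * Complex.I)) hW.aemeasurable
    (Measurable.of_discrete.aestronglyMeasurable), integral_countable]
  · congr with k
    rw [map_measureReal_apply hW (MeasurableSet.of_discrete), Complex.real_smul, ← Complex.exp_nat_mul]
    congr 2
    push_cast
    ring
  · refine Integrable.of_bound (C := 1) (Measurable.of_discrete.aestronglyMeasurable)
      (.of_forall fun k => ?_)
    rw [← Complex.ofReal_mul, Complex.norm_exp_ofReal_mul_I]

end Collector

/-! ### Geometric laws: moments and characteristic function. -/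

/-- The law on `ℝ` of the number of trials up to and including the first success. -/
noncomputable def geometricTrials (p : unitInterval) : Measure ℝ :=
  (geometricMeasure p).map fun k : ℕ => (k : ℝ) + 1

lemma measurable_natCast_add_one : Measurable fun k : ℕ => (k : ℝ) + 1 := Measurable.of_discrete

instance (p : unitInterval) : IsProbabilityMeasure (geometricTrials p) :=
  Measure.isProbabilityMeasure_map measurable_natCast_add_one.aemeasurable

section Geometric

variable {p : unitInterval}

lemma hasSum_geometric_mul (hp : p ≠ 0) : HasSum (fun k : ℕ => (1 - p : ℝ) ^ k * p * ((k : ℝ) + 1)) (1 / p) := by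
  have hp0 : 0 < (p : ℝ) := unitInterval.pos_iff_ne_zero.2 hp
  have hr : ‖(1 - p : ℝ)‖ < 1 := by
    rw [Real.norm_of_nonneg (by linarith [p.2.2])]
    linarith
  have := (hasSum_choose_mul_geometric_of_norm_lt_one 1 hr).mul_right (p : ℝ)
  convert! this using 1
  · ext k
    simp
    ring
  · field_simp
    ring

lemma hasSum_geometric_mul_sq (hp : p ≠ 0) :
    HasSum (fun k : ℕ => (1 - p : ℝ) ^ k * p * ((k : ℝ) + 1) ^ 2) ((2 - p : ℝ) / p ^ 2) := by
  have hp0 : 0 < (p : ℝ) := unitInterval.pos_iff_ne_zero.2 hp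
  have hr : ‖(1 - p : ℝ)‖ < 1 := by
    rw [Real.norm_of_nonneg (by linarith [p.2.2])]
    linarith
  -- Uses `(k + 1)² = 2 · choose (k + 2) 2 - (k + 1)`.
  have := ((hasSum_choose_mul_geometric_of_norm_lt_one 2 hr).mul_right (2 * p : ℝ)).sub
    (hasSum_geometric_mul hp)
  convert! this using 1
  · ext k
    have : ((k + 2).choose 2 : ℝ) = (k + 2) * (k + 1) / 2 := by
      rw [Nat.cast_choose_two]
      push_cast
      ring
    rw [this]
    ring
  · field_simp
    ring

lemma memLp_two_geometricTrials (hp : p ≠ 0) : MemLp id 2 (geometricTrials p) := by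
  rw [geometricTrials, memLp_map_measure_iff (by fun_prop) measurable_natCast_add_one.aemeasurable,
    Function.id_comp, memLp_two_iff_integrable_sq measurable_natCast_add_one.aestronglyMeasurable,
    integrable_geometricMeasure_iff hp]
  refine (hasSum_geometric_mul_sq hp).summable.congr fun k => ?_
  simp

lemma integral_id_geometricTrials (hp : p ≠ 0) : ∫ x, x ∂geometricTrials p = 1 / p := by
  rw [geometricTrials, integral_map measurable_natCast_add_one.aemeasurable (by fun_prop),
    integral_geometricMeasure hp]
  exact (hasSum_geometric_mul hp).tsum_eq

lemma variance_id_geometricTrials (hp : p ≠ 0) :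
    variance id (geometricTrials p) = (1 - p) / p ^ 2 := by
  have hp0 : 0 < (p : ℝ) := unitInterval.pos_iff_ne_zero.2 hp
  rw [variance_eq_sub (memLp_two_geometricTrials hp)]
  have h1 : ∫ x, id x ∂geometricTrials p = 1 / p := integral_id_geometricTrials hp
  have h2 : ∫ x, (id ^ 2 : ℝ → ℝ) x ∂geometricTrials p = (2 - p : ℝ) / p ^ 2 := by
    rw [geometricTrials, integral_map measurable_natCast_add_one.aemeasurable (by fun_prop),
      integral_geometricMeasure hp]
    exact (hasSum_geometric_mul_sq hp).tsum_eq
  rw [h1, h2]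
  field_simp
  ring

lemma charFun_geometricTrials (hp : p ≠ 0) (t : ℝ) : charFun (geometricTrials p) t
    = Complex.exp (t * Complex.I) * p / (1 - Complex.exp (t * Complex.I) * (1 - p)) := by
  have hp0 : 0 < (p : ℝ) := unitInterval.pos_iff_ne_zero.2 hp
  rw [charFun_apply_real, geometricTrials,
    integral_map measurable_natCast_add_one.aemeasurable (by fun_prop),
    integral_geometricMeasure hp]
  have hr : ‖Complex.exp (t * Complex.I) * (1 - p)‖ < 1 := by
    rw [norm_mul, Complex.norm_exp_ofReal_mul_I, one_mul, ← Complex.ofReal_one,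
      ← Complex.ofReal_sub, Complex.norm_real, Real.norm_of_nonneg (by linarith [p.2.2])]
    linarith
  have := ((hasSum_geometric_of_norm_lt_one hr).mul_left (Complex.exp (t * Complex.I) * p)).tsum_eq
  rw [← div_eq_mul_inv] at this
  rw [← this]
  congr with k
  rw [Complex.real_smul, mul_pow, ← Complex.exp_nat_mul]
  have e : Complex.exp (t * ((k : ℝ) + 1 : ℝ) * Complex.I)
      = Complex.exp (k * (t * Complex.I)) * Complex.exp (t * Complex.I) := by
    rw [← Complex.exp_add]
    congr 1
    push_cast
    ring
  rw [e]
  push_cast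
  ring

end Geometric

/-! ### The waiting time as a sum of independent geometric variables. -/

section Law

variable {Ω : Type*} {n : ℕ} {ξ : ℕ → Ω → Fin n} [MeasurableSpace Ω] {P : Measure Ω}
  [IsProbabilityMeasure P]

/-- The probability `(n - i) / n` that a draw shows a new coupon once `i` of them are known. -/
noncomputable def newCouponProb (n : ℕ) (i : ℕ) : unitInterval :=
  ⟨((n - i : ℕ) : ℝ) / n, by positivity, div_le_one_of_le₀ (by gcongr; omega) (by positivity)⟩

lemma coe_newCouponProb {n i : ℕ} (h : i ≤ n) : (newCouponProb n i : ℝ) = ((n : ℝ) - i) / n := by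
  simp [newCouponProb, Nat.cast_sub h]

lemma newCouponProb_ne_zero {n i : ℕ} (h : i < n) : newCouponProb n i ≠ 0 := by
  rw [← unitInterval.pos_iff_ne_zero, ← Subtype.coe_lt_coe, coe_newCouponProb h.le]
  have h1 : (i : ℝ) < n := by exact_mod_cast h
  exact div_pos (by linarith) ((Nat.cast_nonneg i).trans_lt h1)

/-- The characteristic functions agree factor by factor. Equality of laws is enough for the moments,
so the successive waiting times need not be constructed on `Ω`. -/
lemma map_waitingTime_eq (hmeas : ∀ i, Measurable (ξ i)) (hindep : iIndepFun ξ P)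
    (hunif : ∀ (i : ℕ) (k : Fin n), P.real {ω | ξ i ω = k} = 1 / (n : ℝ)) {m : ℕ} (hm : 0 < m)
    (h : m < n) : P.map (fun ω => (waitingTime ξ m ω : ℝ))
      = (Measure.pi fun i : Fin (n - m) => geometricTrials (newCouponProb n i)).map
        fun x => ∑ i, x i := by
  have hWr : Measurable fun ω => (waitingTime ξ m ω : ℝ) :=
    measurable_from_nat.comp (measurable_waitingTime hmeas h)
  have : IsProbabilityMeasure (P.map (fun ω => (waitingTime ξ m ω : ℝ))) :=
    Measure.isProbabilityMeasure_map hWr.aemeasurable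
  refine Measure.ext_of_charFun (funext fun t => ?_)
  rw [charFun_map_waitingTime hmeas hindep hunif hm h, charFun_map_sum_pi_eq_prod,
    Finset.prod_apply, ← Fin.prod_univ_eq_prod_range (fun i : ℕ => Complex.exp (t * Complex.I) *
      (((n : ℂ) - i) / n) / (1 - Complex.exp (t * Complex.I) * (i / n)))]
  refine Finset.prod_congr rfl fun i _ => ?_
  have hi : (i : ℕ) < n := by omega
  have hn : (n : ℂ) ≠ 0 := by
    have : n ≠ 0 := by omega
    exact_mod_cast this
  rw [charFun_geometricTrials (newCouponProb_ne_zero hi), coe_newCouponProb hi.le]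
  push_cast
  congr 3
  field_simp
  ring

lemma sum_fin_sub_eq_sum_Icc {m : ℕ} (h : m < n) (f : ℕ → ℝ) :
    ∑ i : Fin (n - m), f (n - i) = ∑ k ∈ Finset.Icc (m + 1) n, f k := by
  rw [Fin.sum_univ_eq_sum_range fun i => f (n - i)]
  refine Finset.sum_nbij' (fun i => n - i) (fun k => n - k) ?_ ?_ ?_ ?_ ?_
  · intro i hi
    simp at hi ⊢
    omega
  · intro i hi
    simp at hi ⊢
    omega
  · intro i hi
    simp at hi ⊢
    omega
  · intro i hi
    simp at hi ⊢
    omega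
  · intro i _
    rfl

lemma waitingMean_eq (hmeas : ∀ i, Measurable (ξ i)) (hindep : iIndepFun ξ P)
    (hunif : ∀ (i : ℕ) (k : Fin n), P.real {ω | ξ i ω = k} = 1 / (n : ℝ)) {m : ℕ} (hm : 0 < m)
    (h : m < n) : waitingMean P ξ m = ∑ k ∈ Finset.Icc (m + 1) n, (n : ℝ) / k := by
  have hWr : Measurable fun ω => (waitingTime ξ m ω : ℝ) :=
    measurable_from_nat.comp (measurable_waitingTime hmeas h)
  rw [waitingMean, ← integral_map (f := fun x : ℝ => x) hWr.aemeasurable (by fun_prop),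
    map_waitingTime_eq hmeas hindep hunif hm h, integral_map (by fun_prop) (by fun_prop),
    integral_finsetSum]
  · rw [← sum_fin_sub_eq_sum_Icc h fun k => (n : ℝ) / k]
    refine Finset.sum_congr rfl fun i _ => ?_
    have hi : (i : ℕ) < n := by omega
    rw [integral_comp_eval (μ := fun i : Fin (n - m) => geometricTrials (newCouponProb n i))
      (f := fun x : ℝ => x) (by fun_prop), integral_id_geometricTrials (newCouponProb_ne_zero hi),
      coe_newCouponProb hi.le, Nat.cast_sub hi.le, one_div_div]
  · intro i _
    exact integrable_comp_eval (μ := fun i : Fin (n - m) => geometricTrials (newCouponProb n i))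
      (f := fun x : ℝ => x) ((memLp_two_geometricTrials
        (newCouponProb_ne_zero (by omega))).integrable (by norm_num))

lemma waitingVar_eq (hmeas : ∀ i, Measurable (ξ i)) (hindep : iIndepFun ξ P)
    (hunif : ∀ (i : ℕ) (k : Fin n), P.real {ω | ξ i ω = k} = 1 / (n : ℝ)) {m : ℕ} (hm : 0 < m)
    (h : m < n) : waitingVar P ξ m
      = ∑ k ∈ Finset.Icc (m + 1) n, (n : ℝ) * (((n : ℝ) - k) / (k : ℝ) ^ 2) := by
  have hWr : Measurable fun ω => (waitingTime ξ m ω : ℝ) :=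
    measurable_from_nat.comp (measurable_waitingTime hmeas h)
  rw [waitingVar, ← variance_id_map hWr.aemeasurable,
    map_waitingTime_eq hmeas hindep hunif hm h, variance_id_map (by fun_prop)]
  have := variance_sum_pi (μ := fun i : Fin (n - m) => geometricTrials (newCouponProb n i))
    (X := fun _ => id) (fun i => memLp_two_geometricTrials
        (newCouponProb_ne_zero (by omega)))
  have e : (fun x : Fin (n - m) → ℝ => ∑ i, x i) = ∑ i, fun x => id (x i) := by
    ext x
    simp
  rw [e, this, ← sum_fin_sub_eq_sum_Icc h fun k => (n : ℝ) * (((n : ℝ) - k) / (k : ℝ) ^ 2)]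
  refine Finset.sum_congr rfl fun i _ => ?_
  have hi : (i : ℕ) < n := by omega
  have hi' : (0 : ℝ) < n - i := by
    have : (i : ℝ) < n := by exact_mod_cast hi
    linarith
  have hn : (0 : ℝ) < n := by
    have : 0 < n := by omega
    exact_mod_cast this
  rw [variance_id_geometricTrials (newCouponProb_ne_zero hi), coe_newCouponProb hi.le,
    Nat.cast_sub hi.le]
  field_simp

end Law

/-! ### Gaussian distribution functions and integrals. -/

section Gaussian

lemma gaussianPDFReal_le (v : NNReal) (x : ℝ) :
    gaussianPDFReal 0 v x ≤ 1 / Real.sqrt (2 * Real.pi * v) := by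
  rw [gaussianPDFReal, one_div]
  refine mul_le_of_le_one_right (by positivity) (Real.exp_le_one_iff.2 ?_)
  rw [neg_div, neg_nonpos]
  positivity

lemma gaussianReal_real_apply {v : NNReal} (hv : v ≠ 0) {s : Set ℝ} :
    (gaussianReal 0 v).real s = ∫ x in s, gaussianPDFReal 0 v x := by
  rw [measureReal_def, gaussianReal_apply_eq_integral 0 hv,
    ENNReal.toReal_ofReal (integral_nonneg fun x => gaussianPDFReal_nonneg 0 v x)]

lemma cdf_gaussianReal_sub_le {v : NNReal} (hv : v ≠ 0) {x y : ℝ} (h : x ≤ y) :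
    cdf (gaussianReal 0 v) y - cdf (gaussianReal 0 v) x
      ≤ 1 / Real.sqrt (2 * Real.pi * v) * (y - x) := by
  have hi := integrable_gaussianPDFReal 0 v
  rw [cdf_eq_real, cdf_eq_real, gaussianReal_real_apply hv, gaussianReal_real_apply hv,
    intervalIntegral.integral_Iic_sub_Iic hi.integrableOn hi.integrableOn]
  have := intervalIntegral.integral_mono_on h hi.intervalIntegrable
    (g := fun _ => 1 / Real.sqrt (2 * Real.pi * v)) (by simp) fun z _ => gaussianPDFReal_le v z
  rw [intervalIntegral.integral_const, smul_eq_mul] at this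
  linarith

lemma stdNormalCDF_eq (x : ℝ) : stdNormalCDF x = cdf (gaussianReal 0 1) x := by
  rw [cdf_eq_real, gaussianReal_real_apply one_ne_zero, stdNormalCDF, ← integral_const_mul]
  congr with s
  simp [gaussianPDFReal]

lemma cdf_gaussianReal_mul {r : ℝ} (hr : 0 < r) {v : NNReal} (hv : (v : ℝ) = r ^ 2) (x : ℝ) :
    cdf (gaussianReal 0 v) (r * x) = stdNormalCDF x := by
  have h := gaussianReal_map_const_mul (μ := 0) (v := 1) r
  rw [mul_zero, mul_one, show NNReal.mk (r ^ 2) (sq_nonneg r) = v from NNReal.eq hv.symm] at h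
  rw [stdNormalCDF_eq, cdf_eq_real, cdf_eq_real, ← h,
    map_measureReal_apply (by fun_prop) measurableSet_Iic]
  congr 1
  ext y
  rw [Set.mem_preimage, Set.mem_Iic, Set.mem_Iic, mul_le_mul_iff_right₀ hr]

lemma intervalIntegral_exp_neg_mul_sq_le {b : ℝ} (hb : 0 < b) :
    ∫ t in (-1 : ℝ)..1, Real.exp (-b * t ^ 2) ≤ Real.sqrt (Real.pi / b) := by
  rw [← integral_gaussian, intervalIntegral.integral_of_le (by norm_num)]
  exact setIntegral_le_integral (integrable_exp_neg_mul_sq hb)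
    (.of_forall fun t => (Real.exp_pos _).le)

end Gaussian

/-! ### The Berry–Esseen bound for the waiting time. -/

section Collector

variable {Ω : Type*} {n : ℕ} {ξ : ℕ → Ω → Fin n} [MeasurableSpace Ω] {P : Measure Ω}
  [IsProbabilityMeasure P]

lemma exp_mul_geometric_eq_inv_invCenteredGeom {i : ℕ} (h : i < n) (s : ℝ) :
    Complex.exp ((-((n : ℝ) / (n - i) * s) : ℝ) * Complex.I) *
      (Complex.exp (s * Complex.I) * ((n - i) / n) / (1 - Complex.exp (s * Complex.I) * (i / n)))
      = (invCenteredGeom (i / (n - i)) s)⁻¹ := by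
  have hn : (n : ℂ) ≠ 0 := by
    have : n ≠ 0 := by omega
    exact_mod_cast this
  have hi : (n : ℂ) - i ≠ 0 := by
    have : (n : ℂ) ≠ i := by
      have : n ≠ i := by omega
      exact_mod_cast this
    exact sub_ne_zero.2 this
  have hi' : (n : ℝ) - i ≠ 0 := by exact_mod_cast hi
  have e1 : (1 : ℂ) - ((i / (n - i) : ℝ) : ℂ) * (Complex.exp (s * Complex.I) - 1)
      = (1 - Complex.exp (s * Complex.I) * (i / n)) * (n / (n - i)) := by
    push_cast
    field_simp
    ring
  have e2 : Complex.exp (((i / (n - i) * s : ℝ) : ℂ) * Complex.I)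
      = (Complex.exp ((-((n : ℝ) / (n - i) * s) : ℝ) * Complex.I) *
        Complex.exp (s * Complex.I))⁻¹ := by
    rw [← Complex.exp_add, ← Complex.exp_neg]
    congr 1
    push_cast
    field_simp
    ring
  rw [invCenteredGeom, e1, e2, mul_inv, inv_inv, mul_inv, inv_div]
  ring

lemma charFun_map_centered_waitingTime (hmeas : ∀ i, Measurable (ξ i)) (hindep : iIndepFun ξ P)
    (hunif : ∀ (i : ℕ) (k : Fin n), P.real {ω | ξ i ω = k} = 1 / (n : ℝ)) {m : ℕ} (hm : 0 < m)
    (h : m < n) (c t : ℝ) :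
    charFun (P.map fun ω => c * ((waitingTime ξ m ω : ℝ) - waitingMean P ξ m)) t
      = ∏ i ∈ Finset.range (n - m), (invCenteredGeom (i / (n - i)) (c * t))⁻¹ := by
  have hWr : Measurable fun ω => (waitingTime ξ m ω : ℝ) :=
    measurable_from_nat.comp (measurable_waitingTime hmeas h)
  have e : P.map (fun ω => c * ((waitingTime ξ m ω : ℝ) - waitingMean P ξ m))
      = (P.map fun ω => (waitingTime ξ m ω : ℝ)).map fun x => c * (x - waitingMean P ξ m) := by
    rw [Measure.map_map (by fun_prop) hWr]
    rfl
  have hmean : waitingMean P ξ m = ∑ i ∈ Finset.range (n - m), (n : ℝ) / (n - i) := by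
    rw [waitingMean_eq hmeas hindep hunif hm h, ← sum_fin_sub_eq_sum_Icc h fun k => (n : ℝ) / k,
      ← Fin.sum_univ_eq_sum_range fun i : ℕ => (n : ℝ) / (n - i)]
    refine Finset.sum_congr rfl fun i _ => ?_
    rw [Nat.cast_sub (by omega)]
  have e2 : charFun (P.map fun ω => c * ((waitingTime ξ m ω : ℝ) - waitingMean P ξ m)) t
      = Complex.exp ((-(waitingMean P ξ m * (c * t)) : ℝ) * Complex.I) *
        charFun (P.map fun ω => (waitingTime ξ m ω : ℝ)) (c * t) := by
    rw [e, charFun_apply_real, integral_map (by fun_prop) (by fun_prop), charFun_apply_real,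
      ← integral_const_mul]
    congr with x
    rw [← Complex.exp_add]
    congr 1
    push_cast
    ring
  rw [e2, charFun_map_waitingTime hmeas hindep hunif hm h, hmean, Finset.sum_mul,
    ← Finset.sum_neg_distrib, Complex.ofReal_sum, Finset.sum_mul, Complex.exp_sum,
    ← Finset.prod_mul_distrib]
  refine Finset.prod_congr rfl fun i hi => ?_
  rw [Finset.mem_range] at hi
  exact exp_mul_geometric_eq_inv_invCenteredGeom (by omega) (c * t)

lemma waitingVar_eq_sum_range (hmeas : ∀ i, Measurable (ξ i)) (hindep : iIndepFun ξ P)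
    (hunif : ∀ (i : ℕ) (k : Fin n), P.real {ω | ξ i ω = k} = 1 / (n : ℝ)) {m : ℕ} (hm : 0 < m)
    (h : m < n) : ∑ i ∈ Finset.range (n - m), ((i : ℝ) / (n - i)) * (1 + (i : ℝ) / (n - i))
      = waitingVar P ξ m := by
  rw [waitingVar_eq hmeas hindep hunif hm h,
    ← sum_fin_sub_eq_sum_Icc h fun k => (n : ℝ) * (((n : ℝ) - k) / (k : ℝ) ^ 2),
    ← Fin.sum_univ_eq_sum_range fun i : ℕ => ((i : ℝ) / (n - i)) * (1 + (i : ℝ) / (n - i))]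
  refine Finset.sum_congr rfl fun i _ => ?_
  have hi' : (0 : ℝ) < n - i := by
    have : ((i : ℕ) : ℝ) < n := by exact_mod_cast (by omega : (i : ℕ) < n)
    linarith
  rw [Nat.cast_sub (by omega)]
  field_simp
  ring

/-- The term `i = 0` vanishes, since the first draw is always new; `m + 1 < n` guarantees that `i =
1` occurs. -/
lemma waitingVar_pos (hmeas : ∀ i, Measurable (ξ i)) (hindep : iIndepFun ξ P)
    (hunif : ∀ (i : ℕ) (k : Fin n), P.real {ω | ξ i ω = k} = 1 / (n : ℝ)) {m : ℕ} (hm : 0 < m)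
    (h : m + 1 < n) : 0 < waitingVar P ξ m := by
  rw [← waitingVar_eq_sum_range hmeas hindep hunif hm (by omega)]
  have hpos (i : ℕ) (hi : i ∈ Finset.range (n - m)) : (0 : ℝ) < n - i := by
    rw [Finset.mem_range] at hi
    have : (i : ℝ) < n := by exact_mod_cast (by omega : i < n)
    linarith
  refine Finset.sum_pos' (fun i hi => ?_) ⟨1, by rw [Finset.mem_range]; omega, ?_⟩
  · have := hpos i hi
    positivity
  · have := hpos 1 (by rw [Finset.mem_range]; omega)
    positivity

/-- The scale `c` satisfies `(n / m) c = 1 / 2`, so `|t| ≤ 1` is exactly the range of the product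
estimate. -/
lemma norm_charFun_waitingTime_sub_le (hmeas : ∀ i, Measurable (ξ i)) (hindep : iIndepFun ξ P)
    (hunif : ∀ (i : ℕ) (k : Fin n), P.real {ω | ξ i ω = k} = 1 / (n : ℝ)) {m : ℕ} (hm : 0 < m)
    (h : m < n) {c : ℝ} (hc : c = (m : ℝ) / (2 * n)) {v : NNReal}
    (hv : (v : ℝ) = c ^ 2 * waitingVar P ξ m) {t : ℝ} (ht : |t| ≤ 1) :
    ‖charFun (P.map fun ω => c * ((waitingTime ξ m ω : ℝ) - waitingMean P ξ m)) t
      - charFun (gaussianReal 0 v) t‖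
      ≤ |t| * (Real.exp (-1) * Real.exp (-(v / 8) * t ^ 2)) := by
  have hn : (0 : ℝ) < n := by exact_mod_cast (by omega : 0 < n)
  have hm0 : (0 : ℝ) < m := by exact_mod_cast hm
  have hc0 : 0 ≤ c := by rw [hc]; positivity
  have hac : (n : ℝ) / m * c = 1 / 2 := by
    rw [hc]
    field_simp
  have key := norm_prod_invCenteredGeom_sub_exp_le (Finset.range (n - m))
    (α := fun i : ℕ => (i : ℝ) / (n - i)) (a := (n : ℝ) / m) (t := c * t)
    (fun i hi => by
      rw [Finset.mem_range] at hi
      have : (i : ℝ) < n := by exact_mod_cast (by omega : i < n)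
      exact div_nonneg (by positivity) (by linarith))
    (fun i hi => by
      rw [Finset.mem_range] at hi
      have : (m : ℝ) + i ≤ n := by exact_mod_cast (by omega : m + i ≤ n)
      have h2 : (0 : ℝ) < n - i := by linarith
      have : 1 + (i : ℝ) / (n - i) = n / (n - i) := by
        field_simp
        ring
      rw [this]
      gcongr
      linarith)
    (by
      rw [abs_mul, abs_of_nonneg hc0, ← mul_assoc, hac]
      linarith)
    (waitingVar_eq_sum_range hmeas hindep hunif hm h)
  have e : charFun (gaussianReal 0 v) t
      = (Real.exp (-(waitingVar P ξ m * (c * t) ^ 2 / 2)) : ℝ) := by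
    rw [charFun_gaussianReal, Complex.ofReal_exp]
    congr 1
    have : ((v : ℝ) : ℂ) = ((c ^ 2 * waitingVar P ξ m : ℝ) : ℂ) := by rw [hv]
    push_cast at this ⊢
    rw [this]
    ring
  rw [charFun_map_centered_waitingTime hmeas hindep hunif hm h, e]
  refine key.trans ?_
  -- The product estimate reads `|t| x exp (-3/2 x)`. The inequality `x ≤ exp (x - 1)` trades the
  -- factor `x` for part of the decay, leaving `|t| exp (-1) exp (-x / 2)`, an integrable Gaussian.
  set x := (v : ℝ) * t ^ 2 / 4 with hx
  have e1 : waitingVar P ξ m * (n / m) * |c * t| ^ 3 / 2 = |t| * x := by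
    have : |c * t| ^ 3 = c ^ 3 * (|t| * t ^ 2) := by
      rw [abs_mul, abs_of_nonneg hc0, ← sq_abs t]
      ring
    rw [this, hx, hv]
    linear_combination (waitingVar P ξ m * c ^ 2 * |t| * t ^ 2 / 2) * hac
  have e2 : waitingVar P ξ m * (c * t) ^ 2 = 4 * x := by
    rw [hx, hv]
    ring
  rw [e1, e2, mul_assoc]
  have e3 : Real.exp (-1) * Real.exp (-(v / 8) * t ^ 2)
      = Real.exp (x - 1) * Real.exp (-(3 / 8 * (4 * x))) := by
    rw [← Real.exp_add, ← Real.exp_add, hx]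
    congr 1
    ring
  rw [e3]
  gcongr
  linarith [Real.add_one_le_exp (x - 1)]

lemma standardizedCDF_eq (hmeas : ∀ i, Measurable (ξ i)) {m : ℕ} (h : m < n) {c : ℝ} (hc : 0 < c)
    (hσ : 0 < waitingSd P ξ m) (x : ℝ) : standardizedCDF P ξ m x
      = cdf (P.map fun ω => c * ((waitingTime ξ m ω : ℝ) - waitingMean P ξ m))
        (c * waitingSd P ξ m * x) := by
  have hWr : Measurable fun ω => c * ((waitingTime ξ m ω : ℝ) - waitingMean P ξ m) :=
    ((measurable_from_nat.comp (measurable_waitingTime hmeas h)).sub_const _).const_mul c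
  have : IsProbabilityMeasure
      (P.map fun ω => c * ((waitingTime ξ m ω : ℝ) - waitingMean P ξ m)) :=
    Measure.isProbabilityMeasure_map hWr.aemeasurable
  rw [cdf_eq_real, map_measureReal_apply hWr measurableSet_Iic, standardizedCDF]
  congr 1
  ext ω
  simp only [Set.mem_ofPred_eq, Set.mem_preimage, Set.mem_Iic]
  rw [mul_assoc, mul_le_mul_iff_right₀ hc, div_le_iff₀ hσ, mul_comm x]

lemma abs_standardizedCDF_sub_le (hmeas : ∀ i, Measurable (ξ i)) (hindep : iIndepFun ξ P)
    (hunif : ∀ (i : ℕ) (k : Fin n), P.real {ω | ξ i ω = k} = 1 / (n : ℝ)) {m : ℕ} (hm : 0 < m)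
    (h : m + 1 < n) (x : ℝ) : |standardizedCDF P ξ m x - stdNormalCDF x|
      ≤ 9.257 * ((n : ℝ) / m) * (1 / waitingSd P ξ m) := by
  have hmn : m < n := by omega
  have hn0 : (0 : ℝ) < n := by exact_mod_cast (by omega : 0 < n)
  have hm0 : (0 : ℝ) < m := by exact_mod_cast hm
  have hvar := waitingVar_pos hmeas hindep hunif hm h
  have hσ : 0 < waitingSd P ξ m := Real.sqrt_pos.2 hvar
  have hσ2 : waitingSd P ξ m ^ 2 = waitingVar P ξ m := Real.sq_sqrt hvar.le
  set σ := waitingSd P ξ m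
  set c : ℝ := (m : ℝ) / (2 * n) with hc
  have hc0 : 0 < c := by positivity
  set r := c * σ with hr
  have hr0 : 0 < r := by positivity
  obtain ⟨v, hvr⟩ : ∃ v : NNReal, (v : ℝ) = r ^ 2 := ⟨_, Real.coe_toNNReal _ (sq_nonneg r)⟩
  have hv0 : v ≠ 0 := by
    intro h0
    have : (v : ℝ) = 0 := by rw [h0]; rfl
    rw [hvr] at this
    exact (pow_pos hr0 2).ne' this
  have hWr : Measurable fun ω => c * ((waitingTime ξ m ω : ℝ) - waitingMean P ξ m) :=
    ((measurable_from_nat.comp (measurable_waitingTime hmeas hmn)).sub_const _).const_mul c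
  have : IsProbabilityMeasure
      (P.map fun ω => c * ((waitingTime ξ m ω : ℝ) - waitingMean P ξ m)) :=
    Measure.isProbabilityMeasure_map hWr.aemeasurable
  rw [standardizedCDF_eq hmeas hmn hc0 hσ, ← cdf_gaussianReal_mul hr0 hvr]
  have hsmooth := abs_cdf_sub_cdf_le
    (P.map fun ω => c * ((waitingTime ξ m ω : ℝ) - waitingMean P ξ m)) (gaussianReal 0 v)
    (b := fun t => Real.exp (-1) * Real.exp (-(v / 8) * t ^ 2))
    (by apply Continuous.intervalIntegrable; fun_prop)
    (fun t ht => norm_charFun_waitingTime_sub_le hmeas hindep hunif hm hmn hc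
      (by rw [hvr, hr, mul_pow, hσ2]) ht)
    (fun y z hyz => cdf_gaussianReal_sub_le hv0 hyz) (r * x)
  refine hsmooth.trans ?_
  have hint := intervalIntegral_exp_neg_mul_sq_le (b := v / 8) (by rw [hvr]; positivity)
  rw [intervalIntegral.integral_const_mul]
  set ρ := Real.sqrt (2 * Real.pi) with hρ
  have hρ2 : ρ ^ 2 = 2 * Real.pi := Real.sq_sqrt (by positivity)
  have hρ0 : 0 < ρ := by positivity
  have hπ := Real.pi_gt_d2
  have hρ1 : 2.5 ≤ ρ := by
    rw [hρ]
    apply Real.le_sqrt_of_sq_le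
    norm_num
    linarith
  have e1 : Real.sqrt (Real.pi / (v / 8)) = 2 * ρ / r := by
    rw [Real.sqrt_eq_iff_mul_self_eq_of_pos (by positivity), hvr]
    field_simp
    linear_combination 4 * hρ2
  have e2 : Real.sqrt (2 * Real.pi * v) = ρ * r := by
    rw [hvr, Real.sqrt_mul (by positivity), Real.sqrt_sq hr0.le]
  rw [e1] at hint
  rw [e2]
  have hexp : Real.exp (-1) ≤ 1 / 2.7 := by
    rw [Real.exp_neg, ← one_div]
    have := Real.exp_one_gt_d9
    gcongr
    linarith
  have hcr : 1 / r = 2 * (n / m * (1 / σ)) := by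
    rw [hr, hc]
    field_simp
  -- The integral contributes `8 exp (-1) / ρ` and the Lipschitz constant `24 / (π ρ)`, both times
  -- `1 / r`. Numerically the sum is below `4.3 / r`, so `4.6` and the final `9.257` leave slack.
  calc _ ≤ 2 / Real.pi * (1 / 2.7 * (2 * ρ / r)) + 24 / Real.pi * (1 / (ρ * r)) := by
        gcongr
        exact intervalIntegral.integral_nonneg (by norm_num) fun t _ => (Real.exp_pos _).le
    _ = (1 / ρ * (8 / 2.7) + 24 / Real.pi * (1 / ρ)) * (1 / r) := by
        have : Real.pi = ρ ^ 2 / 2 := by linarith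
        rw [this]
        field_simp
        ring
    _ ≤ (1 / 2.5 * (8 / 2.7) + 24 / 3.14 * (1 / 2.5)) * (1 / r) := by gcongr
    _ ≤ 4.6 * (1 / r) := by
        gcongr
        norm_num
    _ = 9.2 * (n / m * (1 / σ)) := by
        rw [hcr]
        ring
    _ ≤ 9.257 * (n / m * (1 / σ)) := by
        gcongr
        norm_num
    _ = _ := by ring

end Collector

theorem theorem4p1 {Ω : Type*} [MeasurableSpace Ω] (P : Measure Ω) [IsProbabilityMeasure P]
    (n m : ℕ) (hn : 3 ≤ n) (hm : 1 ≤ m) (hmn : m ≤ n - 2)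
    (ξ : ℕ → Ω → Fin n)
    (hmeas : ∀ i, Measurable (ξ i))
    (hindep : iIndepFun ξ P)
    (hunif : ∀ (i : ℕ) (k : Fin n), P.real {ω | ξ i ω = k} = 1 / (n : ℝ)) :
    waitingMean P ξ m = (n : ℝ) * ∑ k ∈ Finset.Icc (m + 1) n, 1 / (k : ℝ) ∧
    waitingVar P ξ m
      = (n : ℝ) * ∑ k ∈ Finset.Icc (m + 1) n, ((n : ℝ) - (k : ℝ)) / (k : ℝ) ^ 2 ∧
    (⨆ x : ℝ, |standardizedCDF P ξ m x - stdNormalCDF x|)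
      ≤ 9.257 * ((n : ℝ) / (m : ℝ)) * (1 / waitingSd P ξ m) := by
  refine ⟨?_, ?_, ciSup_le (abs_standardizedCDF_sub_le hmeas hindep hunif hm (by omega))⟩
  · rw [waitingMean_eq hmeas hindep hunif hm (by omega), Finset.mul_sum]
    exact Finset.sum_congr rfl fun k _ => by ring
  · rw [waitingVar_eq hmeas hindep hunif hm (by omega), Finset.mul_sum]
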